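/- Let $K$ be a field of characteristic $\neq 2$, let $f\in K[x]$ be squarefree of degree $5$, and let $F=K(x,y)$, $y^2=f(x)$, be the function field of the genus-2 curve $C: y^2=f(x)$, with place $\infty$ at infinity (the pole of $x$). Let $\mu=(\mu_x,\mu_y)$ and $\omega=(\omega_x,\omega_y)$ be $K$-rational affine points (places) of $C$ with $\mu_x\neq\omega_x$, $\mu_y\neq0$, $\omega_y\neq 0$, and put $D=\mu+\omega-2\infty$, $D_1=2\mu-2\infty$, $D_2=2\omega-2\infty$. Write $[\cdot]$ for classes in the Jacobian $\mathrm{Div}^0(F)/\mathrm{Princ}(F)$. A pair $\langle u,v\rangle$ of polynomials with $u$ monic, $\deg u\le 2$, $\deg v<\deg u$ and $u\mid v^2-f$ is the Mumford representation of the divisor $\sum_{P\ne\infty}\min(v_P(u(x)),v_P(y-v(x)))\,P-(\deg u)\,\infty$. 1. $D,D_1,D_2$ have degree $0$ and $2[D]=[D_1]\oplus[D_2]$. The Mumford representations of $D_1$ and $D_2$ are $\langle u,v\rangle$ and $\langle u',v'\rangle$, where $$u=(x-\mu_x)^2,\quad v=s_\mu(x-\mu_x)+\mu_y,\qquad u'=(x-\omega_x)^2,\quad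 v'=s_\omega(x-\omega_x)+\omega_y,$$ and $s_\mu=f'(\mu_x)/(2\mu_y)$, $s_\omega=f'(\omega_x)/(2\omega_y)$ are the slopes of the tangent lines to $C$ at $\mu$ and $\omega$. 2. For a polynomial $L=px^3+qx^2+rx+s$ over $K$, the congruences $L\equiv v \pmod u$ and $L\equiv v'\pmod{u'}$ hold if and only if $$\begin{pmatrix}3\mu_x^2&2\mu_x&1&0\\-2\mu_x^3&-\mu_x^2&0&1\\3\omega_x^2&2\omega_x&1&0\\-2\omega_x^3&-\omega_x^2&0&1\end{pmatrix}\begin{pmatrix}p\\q\\r\\s\end{pmatrix}=\begin{pmatrix}s_\mu\\\mu_y-s_\mu\mu_x\\s_\omega\\\omega_y-s_\omega\omega_x\end{pmatrix}.$$ The matrix is the matrix $$\begin{pmatrix}a^2-b&-a&1&0\\ab&-b&0&1\\A^2-B&-A&1&0\\AB&-B&0&1\end{pmatrix}$$ of the interpolation system for general $u=x^2+ax+b$, $u'=x^2+Ax+B$, specialised to $a=-2\mu_x$, $b=\mu_x^2$, $A=-2\omega_x$, $B=\omega_x^2$, and the system has exactly one solution. 3. Let $L$ be given by this solution. Then $uu'$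 divides $L^2-f$. Let $u''$ be the quotient $(L^2-f)/(uu')$ divided by its leading coefficient, and let $v''$ be the remainder of $-L$ modulo $u''$. Then $\deg u''=2$ if $p\ne0$ and $\deg u''=1$ if $p=0$. The function $y-L(x)$ vanishes to order $2+\mathrm{mult}_{\mu_x}(u'')$ at $\mu$ and $2+\mathrm{mult}_{\omega_x}(u'')$ at $\omega$, so to order at least $2$ at both, with equality at $\mu$ (at $\omega$) exactly when $u''(\mu_x)\neq0$ ($u''(\omega_x)\ne0$). The pair $\langle u'',L\bmod u''\rangle$ is the Mumford representation of a divisor $E$ of degree $0$, the principal divisor of $y-L(x)$ is $D_1+D_2+E$, and $\langle u'',v''\rangle$ is the Mumford representation of the divisor $D_3$ of degree $0$ that is the image of $E$ under the hyperelliptic involution $(x,y)\mapsto(x,-y)$. Moreover $[D_3]=-[E]$ and $$2[D]=[D_3].$$ -/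

import Mathlib

open Polynomial

namespace GenusTwo

/-- A place of the extension `F / K`, given by its valuation ring `O` with `K ⊊ O ⊊ F`
(the place itself is the maximal ideal of `O`). -/
structure Place (K F : Type*) [Field K] [Field F] [Algebra K F] where
  /-- the valuation ring `O` of the place -/
  ring : ValuationSubring F
  algebraMap_mem : ∀ c : K, algebraMap K F c ∈ ring
  exists_not_const : ∃ z ∈ ring, z ∉ Set.range (algebraMap K F)
  ne_top : ring ≠ ⊤

section Places

variable {K F : Type*} [Field K] [Field F] [Algebra K F]

/-- The valuation ring of a place of `F / K` is a `K`-algebra. -/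
noncomputable instance Place.instAlgebra (P : Place K F) : Algebra K P.ring :=
  ((algebraMap K F).codRestrict P.ring P.algebraMap_mem).toAlgebra

/-- The degree `[O / P : K]` of a place. -/
noncomputable def Place.degree (P : Place K F) : ℕ :=
  Module.finrank K (IsLocalRing.ResidueField P.ring)

/-- `P.HasOrder z n` says that `v_P(z) = n`: there are a uniformizer `t` of the valuation ring
(a generator of its maximal ideal) and a unit `e` of it with `z = t ^ n * e`. -/
def Place.HasOrder (P : Place K F) (z : F) (n : ℤ) : Prop :=
  ∃ (t : P.ring) (e : P.ringˣ),
    IsLocalRing.maximalIdeal P.ring = Ideal.span {t} ∧ z = (t : F) ^ n * ((e : P.ring) : F)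

/-- `P` lies at the affine point `(a, b)`: the residues satisfy `x(P) = a` and `y(P) = b`. -/
def Place.IsAt (P : Place K F) (x y : F) (a b : K) : Prop :=
  x - algebraMap K F a ∈ P.ring.nonunits ∧ y - algebraMap K F b ∈ P.ring.nonunits

/-- `P` lies at infinity: it is a pole of `x`. -/
def Place.IsInfinite (P : Place K F) (x : F) : Prop := x ∉ P.ring

/-- The inverse image of a place under a `K`-automorphism of `F`. -/
def Place.comap (P : Place K F) (σ : F ≃ₐ[K] F) : Place K F where
  ring := P.ring.comap (σ : F →+* F)
  algebraMap_mem c := by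
    simpa [ValuationSubring.mem_comap] using P.algebraMap_mem c
  exists_not_const := by
    obtain ⟨z, hz, hc⟩ := P.exists_not_const
    refine ⟨σ.symm z, by simpa [ValuationSubring.mem_comap] using hz, ?_⟩
    rintro ⟨c, h⟩
    exact hc ⟨c, by simpa using congrArg σ h⟩
  ne_top h := P.ne_top <| by
    rw [eq_top_iff]
    intro z _
    have hz : σ.symm z ∈ P.ring.comap (σ : F →+* F) := h ▸ ValuationSubring.mem_top _
    simpa [ValuationSubring.mem_comap] using hz

end Places

/-- Divisors: finite formal integer combinations of places. -/
abbrev Divisor (K F : Type*) [Field K] [Field F] [Algebra K F] := Place K F →₀ ℤ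

/-- The degree of a divisor, `∑ n_P * deg P`. -/
noncomputable def divisorDegree (K F : Type*) [Field K] [Field F] [Algebra K F] :
    Divisor K F →+ ℤ :=
  Finsupp.liftAddHom fun P => AddMonoidHom.mulRight (P.degree : ℤ)

/-- The group of divisors of degree zero. -/
noncomputable def degreeZero (K F : Type*) [Field K] [Field F] [Algebra K F] :
    AddSubgroup (Divisor K F) :=
  (divisorDegree K F).ker

/-- `D` is the principal divisor `(z)`. -/
def IsDivisorOf {K F : Type*} [Field K] [Field F] [Algebra K F] (D : Divisor K F) (z : F) :
    Prop :=
  z ≠ 0 ∧ ∀ P : Place K F, P.HasOrder z (D P)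

/-- The group of principal divisors. -/
noncomputable def principal (K F : Type*) [Field K] [Field F] [Algebra K F] : AddSubgroup (Divisor K F) :=
  AddSubgroup.closure {D | ∃ z : F, IsDivisorOf D z}

/-- The Jacobian: divisors of degree zero modulo principal divisors. -/
abbrev Jacobian (K F : Type*) [Field K] [Field F] [Algebra K F] :=
  degreeZero K F ⧸ (principal K F).addSubgroupOf (degreeZero K F)

/-- The class `[D]` of a divisor of degree zero. -/
noncomputable def divisorClass {K F : Type*} [Field K] [Field F] [Algebra K F]
    (D : Divisor K F) (hD : D ∈ degreeZero K F) : Jacobian K F :=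
  QuotientAddGroup.mk' _ ⟨D, hD⟩

/-- `F` is the function field `K(x, y)` of the genus two curve `y² = f(x)`, where `2 ≠ 0` in `K`
and `f` is a squarefree polynomial of degree five. -/
structure IsFunctionField {K F : Type*} [Field K] [Field F] [Algebra K F]
    (f : K[X]) (x y : F) : Prop where
  two_ne_zero : (2 : K) ≠ 0
  natDegree_eq : f.natDegree = 5
  squarefree : Squarefree f
  transcendental : Transcendental K x
  equation : y ^ 2 = aeval x f
  adjoin_eq_top : IntermediateField.adjoin K {x, y} = ⊤

/-- `⟨u, v⟩` is the Mumford representation of the divisor `D`: `u` is monic of degree at most two,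
`deg v < deg u`, `u ∣ v² - f`, and `D = ∑ min (v_P(u(x)), v_P(y - v(x))) P - (deg u) ∞`,
the sum being over all places `P` other than the place `∞` at infinity. -/
structure IsMumford {K F : Type*} [Field K] [Field F] [Algebra K F]
    (f : K[X]) (x y : F) (infty : Place K F) (u v : K[X]) (D : Divisor K F) : Prop where
  monic : u.Monic
  natDegree_le : u.natDegree ≤ 2
  degree_lt : v.degree < u.degree
  dvd : u ∣ v ^ 2 - f
  apply_infty : D infty = -(u.natDegree : ℤ)
  apply_affine : ∀ P : Place K F, P ≠ infty → ∃ m n : ℤ,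
    P.HasOrder (aeval x u) m ∧ P.HasOrder (y - aeval x v) n ∧ D P = min m n

section Interpolation

variable {K : Type*} [Field K]

/-- The slope `dy/dx = f'(a) / (2 b)` of the tangent line to `y² = f(x)` at `(a, b)`, `b ≠ 0`,
obtained by formal differentiation of `y² - f(x)`. -/
noncomputable def tangentSlope (f : K[X]) (a b : K) : K := f.derivative.eval a / (2 * b)

/-- The polynomial of the tangent line to `y² = f(x)` at `(a, b)`. -/
noncomputable def tangentLine (f : K[X]) (a b : K) : K[X] :=
  C (tangentSlope f a b) * (X - C a) + C b

/-- The polynomial `p x³ + q x² + r x + s` with coefficient vector `(p, q, r, s)`. -/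
noncomputable def cubic (w : Fin 4 → K) : K[X] :=
  C (w 0) * X ^ 3 + C (w 1) * X ^ 2 + C (w 2) * X + C (w 3)

/-- The matrix of the linear system for the coefficients `(p, q, r, s)` of `L` that expresses
`L ≡ c x + d mod x² + a x + b` and `L ≡ C x + D mod x² + A x + B`; the right-hand side of the
system is `(c, d, C, D)`. -/
def interpolationMatrix (a b A B : K) : Matrix (Fin 4) (Fin 4) K :=
  !![a ^ 2 - b, -a, 1, 0;
     a * b, -b, 0, 1;
     A ^ 2 - B, -A, 1, 0;
     A * B, -B, 0, 1]

end Interpolation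

end GenusTwo

open GenusTwo

namespace GenusTwo

/-! ### Hermite interpolation at two abscissae, and degrees of norms. -/

section Interpolation

variable {K : Type*} [Field K]

/-! Since 2D = D₁ + D₂ already holds for divisors, the theorem comes down to the divisors of two
functions, `y - L(x)` and `u''(x)`. The two congruences on `L` are Hermite interpolation at distinct
abscissae, so they have a unique solution. The norm of `y - L(x)` over K(x) is `L² - f`. It is
divisible by the coprime polynomials u and u', because a tangent line meets the curve doubly; its
degree is 6 or 5 according to whether p ≠ 0, so the residual factor u'' has degree 2 or 1. Then
div(y - L) = D₁ + D₂ + E and div(u''(x)) = E + D₃, whence 2[D] = -[E] = [D₃].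

The substance is local, because a place is an arbitrary valuation ring. Above a prime π of K[x], π
is a uniformizer if it does not divide f, and y is one if it does; this makes every affine place
discrete. When y has the residue of g(x), the pair (π, g) determines the place, whose degree is deg
π; conversely such a place exists as soon as π divides g² - f. The coordinates 1/x and y/x³ turn the
place at infinity into a ramified affine place, so x and y have poles of order 2 and 5 there.

Divisors are then computed through `IsFunctionField.ord_sub_ord_add_cases`: at an affine place,
either one of y - w(x), y + w(x) is a unit, or both have order 1 and every nonzero polynomial in x
has even order. Consequently min(ord u, ord(y - v)) is additive in u as long as the product of the
factors divides v² - f (`min_ord_mul`), and it depends on v only modulo u (`min_ord_congr`). Mumford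
representations can thus be multiplied, and div(y - L) can be read off from the factorisation of `L²
- f`. -/

theorem interpolationMatrix_square (a b : K) :
    interpolationMatrix (-2 * a) (a ^ 2) (-2 * b) (b ^ 2) =
      !![3 * a ^ 2, 2 * a, 1, 0;
         -2 * a ^ 3, -a ^ 2, 0, 1;
         3 * b ^ 2, 2 * b, 1, 0;
         -2 * b ^ 3, -b ^ 2, 0, 1] := by
  ext i j
  fin_cases i <;> fin_cases j <;> simp [interpolationMatrix] <;> ring

/-- Up to unimodular row operations this is the confluent Vandermonde matrix of value and derivative
at two points, hence invertible exactly when the points differ. -/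
theorem det_interpolationMatrix_square (a b : K) :
    (interpolationMatrix (-2 * a) (a ^ 2) (-2 * b) (b ^ 2)).det = (a - b) ^ 4 := by
  rw [interpolationMatrix_square, Matrix.det_succ_row_zero]
  simp [Matrix.det_fin_three, Fin.sum_univ_four, Fin.succAbove, Matrix.submatrix]
  ring

theorem sq_dvd_linear_iff (a c d : K) : (X - C a) ^ 2 ∣ C c * X + C d ↔ c = 0 ∧ d = 0 := by
  constructor
  · intro h
    have h0 : C c * X + C d = 0 := by
      refine eq_zero_of_dvd_of_degree_lt h ?_
      rw [degree_pow, degree_X_sub_C]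
      exact degree_linear_le.trans_lt (by norm_num)
    have h1 := congrArg (fun p => coeff p 1) h0
    have h2 := congrArg (fun p => coeff p 0) h0
    simpa using And.intro h1 h2
  · rintro ⟨rfl, rfl⟩
    simp

theorem sq_dvd_cubic_sub_iff (w : Fin 4 → K) (a b s : K) :
    (X - C a) ^ 2 ∣ cubic w - (C s * (X - C a) + C b) ↔
      3 * a ^ 2 * w 0 + 2 * a * w 1 + w 2 = s ∧
      -2 * a ^ 3 * w 0 - a ^ 2 * w 1 + w 3 = b - s * a := by
  -- Division of the cubic by (X - a)²: the coefficients of the linear remainder are the two rows of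
  -- the system belonging to a.
  have e : cubic w - (C s * (X - C a) + C b) =
      (C (3 * a ^ 2 * w 0 + 2 * a * w 1 + w 2 - s) * X +
        C (-2 * a ^ 3 * w 0 - a ^ 2 * w 1 + w 3 - (b - s * a))) +
      (X - C a) ^ 2 * (C (w 0) * X + C (w 1 + 2 * a * w 0)) := by
    simp only [cubic, C_add, C_sub, C_mul, C_pow, C_neg, map_ofNat]
    ring
  rw [e, dvd_add_left (dvd_mul_right _ _), sq_dvd_linear_iff, sub_eq_zero, sub_eq_zero]

theorem mulVec_interpolationMatrix_iff (f : K[X]) (a b c d : K) (w : Fin 4 → K) :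
    (interpolationMatrix (-2 * a) (a ^ 2) (-2 * c) (c ^ 2)).mulVec w =
      ![tangentSlope f a b, b - tangentSlope f a b * a,
        tangentSlope f c d, d - tangentSlope f c d * c] ↔
      (X - C a) ^ 2 ∣ cubic w - tangentLine f a b ∧
        (X - C c) ^ 2 ∣ cubic w - tangentLine f c d := by
  rw [tangentLine, tangentLine, sq_dvd_cubic_sub_iff, sq_dvd_cubic_sub_iff,
    interpolationMatrix_square, funext_iff]
  simp only [Matrix.mulVec, dotProduct, Fin.sum_univ_four, Fin.forall_fin_succ]
  simp [sub_eq_add_neg, and_assoc]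

theorem existsUnique_mulVec {n : Type*} [Fintype n] [DecidableEq n] (M : Matrix n n K)
    (hM : M.det ≠ 0) (r : n → K) : ∃! w, M.mulVec w = r := by
  have hu : IsUnit M.det := isUnit_iff_ne_zero.2 hM
  refine ⟨M⁻¹.mulVec r, ?_, fun w hw => ?_⟩
  · simp [Matrix.mulVec_mulVec, Matrix.mul_nonsing_inv _ hu]
  · simp [← hw, Matrix.mulVec_mulVec, Matrix.nonsing_inv_mul _ hu]

theorem sq_dvd_of_isRoot {p : K[X]} {a : K} (h0 : p.IsRoot a) (h1 : p.derivative.IsRoot a) :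
    (X - C a) ^ 2 ∣ p := by
  obtain ⟨q, rfl⟩ := dvd_iff_isRoot.2 h0
  have h2 : q.IsRoot a := by simpa [IsRoot] using h1
  rw [sq]
  exact mul_dvd_mul_left _ (dvd_iff_isRoot.2 h2)

/-- At a the value is b² - f(a) = 0, and the derivative 2bs - f'(a) vanishes by the choice of the
slope s. -/
theorem sq_dvd_tangentLine_sq_sub (h2 : (2 : K) ≠ 0) {f : K[X]} {a b : K} (hb : b ≠ 0)
    (hf : f.eval a = b ^ 2) : (X - C a) ^ 2 ∣ tangentLine f a b ^ 2 - f := by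
  apply sq_dvd_of_isRoot
  · simp [IsRoot, tangentLine, hf]
  · simp [IsRoot, tangentLine, tangentSlope, derivative_pow]
    field_simp
    ring

theorem natDegree_cubic_le (w : Fin 4 → K) : (cubic w).natDegree ≤ 3 :=
  Polynomial.natDegree_cubic_le

theorem natDegree_cubic_eq_three_iff (w : Fin 4 → K) : (cubic w).natDegree = 3 ↔ w 0 ≠ 0 := by
  constructor
  · rintro h h0
    have := natDegree_quadratic_le (a := w 1) (b := w 2) (c := w 3)
    simp only [cubic, h0, C_0, zero_mul, zero_add] at h
    omega
  · intro h
    exact Polynomial.natDegree_cubic h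

/-- No leading terms cancel: L² has even degree, either 6 or at most 4, while f has degree 5. -/
theorem natDegree_sq_sub {L f : K[X]} (hf : f.natDegree = 5) (hL : L.natDegree ≤ 3) :
    (L ^ 2 - f).natDegree = if L.natDegree = 3 then 6 else 5 := by
  have h := natDegree_pow L 2
  split_ifs with h3
  · rw [natDegree_sub_eq_left_of_natDegree_lt (by omega), h, h3]
  · rw [natDegree_sub_eq_right_of_natDegree_lt (by omega), hf]

theorem isCoprime_sq {a b : K} (hab : a ≠ b) :
    IsCoprime ((X - C a) ^ 2) ((X - C b) ^ 2) :=
  (isCoprime_X_sub_C_of_isUnit_sub (sub_ne_zero.2 hab).isUnit).pow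

end Interpolation

section FunctionField

variable {K F : Type*} [Field K] [Field F] [Algebra K F]

/-! ### The valuation of a place on constants and on polynomials in x. -/

namespace Place

variable (P : Place K F)

theorem valuation_algebraMap_le_one (c : K) : P.ring.valuation (algebraMap K F c) ≤ 1 :=
  (P.ring.valuation_le_one_iff _).2 (P.algebraMap_mem c)

theorem valuation_algebraMap {c : K} (hc : c ≠ 0) : P.ring.valuation (algebraMap K F c) = 1 := by
  refine le_antisymm (P.valuation_algebraMap_le_one c) ?_
  have h := P.valuation_algebraMap_le_one c⁻¹
  rw [map_inv₀, map_inv₀] at h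
  exact (inv_le_one₀ (by simpa [zero_lt_iff] using hc)).1 h

theorem eq_zero_of_algebraMap_lt_one {c : K} (h : P.ring.valuation (algebraMap K F c) < 1) :
    c = 0 := by
  by_contra hc
  exact h.ne (P.valuation_algebraMap hc)

variable {P}

theorem aeval_mem {x : F} (hx : x ∈ P.ring) (p : K[X]) : aeval x p ∈ P.ring := by
  rw [aeval_eq_sum_range]
  refine sum_mem fun i _ => ?_
  rw [Algebra.smul_def]
  exact mul_mem (P.algebraMap_mem _) (pow_mem hx i)

theorem valuation_aeval_le_one {x : F} (hx : x ∈ P.ring) (p : K[X]) :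
    P.ring.valuation (aeval x p) ≤ 1 :=
  (P.ring.valuation_le_one_iff _).2 (aeval_mem hx p)

theorem valuation_mul_lt_one_left {a b : F} (ha : P.ring.valuation a < 1)
    (hb : P.ring.valuation b ≤ 1) : P.ring.valuation (a * b) < 1 := by
  rw [map_mul]
  exact mul_lt_one_of_lt_of_le ha hb

theorem valuation_mul_lt_one_right {a b : F} (ha : P.ring.valuation a ≤ 1)
    (hb : P.ring.valuation b < 1) : P.ring.valuation (a * b) < 1 := by
  rw [mul_comm]
  exact valuation_mul_lt_one_left hb ha

theorem valuation_aeval_lt_one_of_dvd {x : F} (hx : x ∈ P.ring) {π p : K[X]}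
    (hπ : P.ring.valuation (aeval x π) < 1) (h : π ∣ p) : P.ring.valuation (aeval x p) < 1 := by
  obtain ⟨q, rfl⟩ := h
  rw [map_mul]
  exact valuation_mul_lt_one_left hπ (valuation_aeval_le_one hx q)

/-- Otherwise a Bézout relation between π and p would put 1 in the maximal ideal. -/
theorem valuation_aeval_eq_one {x : F} (hx : x ∈ P.ring) {π p : K[X]} (hirr : Irreducible π)
    (hπ : P.ring.valuation (aeval x π) < 1) (h : ¬ π ∣ p) : P.ring.valuation (aeval x p) = 1 := by
  refine le_antisymm (valuation_aeval_le_one hx p) (not_lt.1 fun hp => ?_)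
  obtain ⟨a, b, hab⟩ := hirr.coprime_iff_not_dvd.2 h
  have h1 : P.ring.valuation (aeval x (a * π + b * p)) < 1 := by
    rw [map_add, map_mul, map_mul]
    exact Valuation.map_add_lt _ (valuation_mul_lt_one_right (valuation_aeval_le_one hx a) hπ)
      (valuation_mul_lt_one_right (valuation_aeval_le_one hx b) hp)
  simp [hab] at h1

theorem valuation_aeval_lt_one_iff {x : F} (hx : x ∈ P.ring) {π p : K[X]} (hirr : Irreducible π)
    (hπ : P.ring.valuation (aeval x π) < 1) : P.ring.valuation (aeval x p) < 1 ↔ π ∣ p :=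
  ⟨fun h => by_contra fun hp => h.ne (valuation_aeval_eq_one hx hirr hπ hp),
    valuation_aeval_lt_one_of_dvd hx hπ⟩

end Place

/-- The function field of `y² = f(x)`, without any condition on the shape of `f`. -/
structure IsQuadraticModel (f : K[X]) (x y : F) : Prop where
  two_ne_zero : (2 : K) ≠ 0
  transcendental : Transcendental K x
  equation : y ^ 2 = aeval x f
  adjoin_eq_top : IntermediateField.adjoin K {x, y} = ⊤

theorem IsFunctionField.isQuadraticModel {f : K[X]} {x y : F} (h : IsFunctionField f x y) :
    IsQuadraticModel f x y :=
  ⟨h.two_ne_zero, h.transcendental, h.equation, h.adjoin_eq_top⟩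

/-! ### The prime of K[x] below an affine place. -/

namespace IsQuadraticModel

variable {f : K[X]} {x y : F} (h : IsQuadraticModel f x y)
include h

theorem aeval_ne_zero {p : K[X]} (hp : p ≠ 0) : aeval x p ≠ 0 :=
  fun h0 => hp (transcendental_iff.1 h.transcendental p h0)

theorem exists_eq_of_mem_adjoin {z : F} (hz : z ∈ Algebra.adjoin K {x, y}) :
    ∃ a b : K[X], z = aeval x a + aeval x b * y := by
  induction hz using Algebra.adjoin_induction with
  | mem z hz =>
    rcases hz with rfl | rfl
    · exact ⟨X, 0, by simp⟩
    · exact ⟨0, 1, by simp⟩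
  | algebraMap r => exact ⟨C r, 0, by simp⟩
  | add z w _ _ hz hw =>
    obtain ⟨a, b, rfl⟩ := hz
    obtain ⟨c, d, rfl⟩ := hw
    exact ⟨a + c, b + d, by simp only [map_add]; ring⟩
  | mul z w _ _ hz hw =>
    obtain ⟨a, b, rfl⟩ := hz
    obtain ⟨c, d, rfl⟩ := hw
    refine ⟨a * c + b * d * f, a * d + b * c, ?_⟩
    simp only [map_add, map_mul, ← h.equation]
    ring

omit h in
theorem aeval_mem_adjoin (x y : F) (a : K[X]) : aeval x a ∈ Algebra.adjoin K {x, y} :=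
  Algebra.adjoin_mono (by simp) (aeval_mem_adjoin_singleton K x (p := a))

omit h in
theorem right_mem_adjoin (x y : F) : y ∈ Algebra.adjoin K {x, y} :=
  Algebra.subset_adjoin (by simp)

theorem right_mem_ring {P : Place K F} (hx : x ∈ P.ring) : y ∈ P.ring := by
  rw [← P.ring.valuation_le_one_iff]
  refine (pow_le_one_iff (n := 2) (by simp)).1 ?_
  rw [← map_pow, h.equation]
  exact Place.valuation_aeval_le_one hx f

theorem adjoin_le {P : Place K F} (hx : x ∈ P.ring) {z : F} (hz : z ∈ Algebra.adjoin K {x, y}) :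
    z ∈ P.ring := by
  obtain ⟨a, b, rfl⟩ := h.exists_eq_of_mem_adjoin hz
  exact add_mem (Place.aeval_mem hx a) (mul_mem (Place.aeval_mem hx b) (h.right_mem_ring hx))

/-- Below an affine place there is a prime of `K[x]`. -/
theorem exists_irreducible {P : Place K F} (hx : x ∈ P.ring) :
    ∃ π : K[X], π.Monic ∧ Irreducible π ∧ P.ring.valuation (aeval x π) < 1 := by
  by_cases hz : ∃ p : K[X], p ≠ 0 ∧ P.ring.valuation (aeval x p) < 1
  · obtain ⟨p, hp, hlt⟩ := hz
    by_contra! hcon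
    -- If no monic irreducible polynomial lies in the maximal ideal, factorisation makes every
    -- nonzero polynomial a unit.
    have key : ∀ p : K[X], p ≠ 0 → P.ring.valuation (aeval x p) = 1 := by
      intro p hp
      induction p using UniqueFactorizationMonoid.induction_on_prime with
      | h₁ => exact (hp rfl).elim
      | h₂ p hu =>
        obtain ⟨c, hc, rfl⟩ := Polynomial.isUnit_iff.1 hu
        simpa using P.valuation_algebraMap hc.ne_zero
      | h₃ a p ha hpr ih =>
        rw [map_mul, map_mul, ih ha, mul_one]
        refine le_antisymm (Place.valuation_aeval_le_one hx p) ?_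
        have h1 := hcon (p * C p.leadingCoeff⁻¹) (monic_mul_leadingCoeff_inv hpr.ne_zero)
          (irreducible_mul_leadingCoeff_inv.2 hpr.irreducible)
        rwa [map_mul, map_mul, aeval_C, P.valuation_algebraMap
          (inv_ne_zero (leadingCoeff_ne_zero.2 hpr.ne_zero)), mul_one] at h1
    exact hlt.ne (key p hp)
  -- With no nonzero polynomial in the maximal ideal, the valuation ring contains K(x).
  -- Rationalising denominators by norms then shows that it is all of F.
  · exfalso
    push Not at hz
    apply P.ne_top
    have hone : ∀ p : K[X], (aeval x p)⁻¹ ∈ P.ring := by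
      intro p
      by_cases hp : p = 0
      · simp [hp]
      · rw [← P.ring.valuation_le_one_iff, map_inv₀]
        exact inv_le_one_of_one_le₀ (hz p hp)
    rw [eq_top_iff]
    intro z _
    have hz' : z ∈ IntermediateField.adjoin K {x, y} := h.adjoin_eq_top ▸ IntermediateField.mem_top
    obtain ⟨r, hr, s, hs, rfl⟩ := IntermediateField.mem_adjoin_iff_div.1 hz'
    rw [div_eq_mul_inv]
    refine mul_mem (h.adjoin_le hx hr) ?_
    obtain ⟨a, b, rfl⟩ := h.exists_eq_of_mem_adjoin hs
    -- A quadratic model allows f to be a square, so the norm of a + by may vanish. In that case a +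
    -- by is 0 or 2a, a polynomial in x.
    by_cases hN : a ^ 2 - b ^ 2 * f = 0
    · have h0 : (aeval x a + aeval x b * y) * (aeval x a - aeval x b * y) = 0 := by
        have := congrArg (aeval x) hN
        simp only [map_sub, map_mul, map_pow, ← h.equation, map_zero] at this
        linear_combination this
      rcases mul_eq_zero.1 h0 with h0 | h0
      · simp [h0]
      · have : aeval x a + aeval x b * y = aeval x (2 * a) := by
          simp only [map_mul, map_ofNat]
          linear_combination -h0
        rw [this]
        exact hone _
    · have hN' := h.aeval_ne_zero hN
      have : (aeval x a + aeval x b * y)⁻¹ =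
          (aeval x a - aeval x b * y) * (aeval x (a ^ 2 - b ^ 2 * f))⁻¹ := by
        have e : aeval x (a ^ 2 - b ^ 2 * f) =
            (aeval x a + aeval x b * y) * (aeval x a - aeval x b * y) := by
          simp only [map_sub, map_mul, map_pow, ← h.equation]
          ring
        rw [e] at hN' ⊢
        have h1 := left_ne_zero_of_mul hN'
        have h2 := right_ne_zero_of_mul hN'
        field_simp
      rw [this]
      exact mul_mem (sub_mem (Place.aeval_mem hx a)
        (mul_mem (Place.aeval_mem hx b) (h.right_mem_ring hx))) (hone _)

end IsQuadraticModel

/-- `z` is a power of `t` times a quotient of two elements of `A` that are units at `P`. -/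
def IsLocalFraction (A : Subalgebra K F) (P : Place K F) (t z : F) : Prop :=
  ∃ n : ℤ, ∃ u ∈ A, ∃ w ∈ A, P.ring.valuation u = 1 ∧ P.ring.valuation w = 1 ∧
    z = t ^ n * (u / w)

/-! ### Calculus of local fractions. -/

namespace IsLocalFraction

variable {A : Subalgebra K F} {P : Place K F} {t z z' : F}

theorem of_unit (hz : z ∈ A) (hv : P.ring.valuation z = 1) : IsLocalFraction A P t z :=
  ⟨0, z, hz, 1, one_mem A, hv, map_one _, by simp⟩

theorem self : IsLocalFraction A P t t :=
  ⟨1, 1, one_mem A, 1, one_mem A, map_one _, map_one _, by simp⟩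

theorem mul (ht : t ≠ 0) (h : IsLocalFraction A P t z) (h' : IsLocalFraction A P t z') :
    IsLocalFraction A P t (z * z') := by
  obtain ⟨n, u, hu, w, hw, vu, vw, rfl⟩ := h
  obtain ⟨n', u', hu', w', hw', vu', vw', rfl⟩ := h'
  refine ⟨n + n', u * u', mul_mem hu hu', w * w', mul_mem hw hw', by simp [vu, vu'],
    by simp [vw, vw'], ?_⟩
  rw [zpow_add₀ ht]
  ring

theorem inv (h : IsLocalFraction A P t z) : IsLocalFraction A P t z⁻¹ := by
  obtain ⟨n, u, hu, w, hw, vu, vw, rfl⟩ := h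
  exact ⟨-n, w, hw, u, hu, vw, vu, by rw [mul_inv, zpow_neg, inv_div]⟩

theorem div (ht : t ≠ 0) (h : IsLocalFraction A P t z) (h' : IsLocalFraction A P t z') :
    IsLocalFraction A P t (z / z') := by
  rw [div_eq_mul_inv]
  exact h.mul ht h'.inv

theorem pow (ht : t ≠ 0) (h : IsLocalFraction A P t z) (n : ℕ) :
    IsLocalFraction A P t (z ^ n) := by
  induction n with
  | zero => exact ⟨0, 1, one_mem A, 1, one_mem A, map_one _, map_one _, by simp⟩
  | succ n ih => rw [pow_succ]; exact ih.mul ht h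

theorem exists_valuation_eq (h : IsLocalFraction A P t z) :
    ∃ n : ℤ, P.ring.valuation z = P.ring.valuation t ^ n := by
  obtain ⟨n, u, hu, w, hw, vu, vw, rfl⟩ := h
  exact ⟨n, by simp [vu, vw]⟩

theorem add_of_lt (htA : t ∈ A) (ht0 : t ≠ 0)
    (ht : P.ring.valuation t < 1)
    (h : IsLocalFraction A P t z) (h' : IsLocalFraction A P t z')
    (hlt : P.ring.valuation z' < P.ring.valuation z) : IsLocalFraction A P t (z + z') := by
  obtain ⟨n, u, hu, w, hw, vu, vw, rfl⟩ := h
  obtain ⟨n', u', hu', w', hw', vu', vw', rfl⟩ := h'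
  have hpos : 0 < P.ring.valuation t := by simpa [zero_lt_iff] using ht0
  simp only [map_mul, map_zpow₀, map_div₀, vu, vw, vu', vw', div_one, mul_one] at hlt
  rw [zpow_lt_zpow_iff_right_of_lt_one₀ hpos ht] at hlt
  -- The dominated term carries at least one more factor t. Once t ^ n is taken out, the combined
  -- numerator is a unit plus a multiple of t, and it stays in `A` because t does.
  obtain ⟨k, rfl⟩ : ∃ k : ℕ, n' = n + (k + 1 : ℕ) := ⟨(n' - n - 1).toNat, by omega⟩
  have hw0 : w ≠ 0 := by rintro rfl; simp at vw
  have hw0' : w' ≠ 0 := by rintro rfl; simp at vw'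
  refine ⟨n, u * w' + t ^ (k + 1) * u' * w, add_mem (mul_mem hu hw')
    (mul_mem (mul_mem (pow_mem htA _) hu') hw), w * w', mul_mem hw hw', ?_, by simp [vw, vw'], ?_⟩
  · rw [Valuation.map_add_eq_of_lt_left, map_mul, vu, vw', one_mul]
    simp only [map_mul, map_pow, vu, vu', vw, vw', mul_one]
    exact pow_lt_one₀ zero_le ht (by omega)
  · rw [zpow_add₀ ht0, zpow_natCast]
    field_simp

end IsLocalFraction

/-! ### Uniformizers at affine places: π when unramified, y when ramified. -/

namespace IsQuadraticModel

variable {f : K[X]} {x y : F} (h : IsQuadraticModel f x y)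
include h

theorem isLocalFraction_of_forall_adjoin {P : Place K F} {t : F} (ht : t ≠ 0)
    (H : ∀ z ∈ Algebra.adjoin K {x, y}, z ≠ 0 → IsLocalFraction (Algebra.adjoin K {x, y}) P t z)
    {z : F} (hz : z ≠ 0) : IsLocalFraction (Algebra.adjoin K {x, y}) P t z := by
  have hz' : z ∈ IntermediateField.adjoin K {x, y} := h.adjoin_eq_top ▸ IntermediateField.mem_top
  obtain ⟨r, hr, s, hs, rfl⟩ := IntermediateField.mem_adjoin_iff_div.1 hz'
  exact (H r hr fun h0 => hz (by simp [h0])).div ht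
    (H s hs fun h0 => hz (by simp [h0]))

omit h in
theorem isLocalFraction_aeval {P : Place K F} {t : F} (ht : t ≠ 0) (hx : x ∈ P.ring) {π : K[X]}
    (hirr : Irreducible π) (hπ : P.ring.valuation (aeval x π) < 1)
    (hπt : IsLocalFraction (Algebra.adjoin K {x, y}) P t (aeval x π)) {a : K[X]} (ha : a ≠ 0) :
    IsLocalFraction (Algebra.adjoin K {x, y}) P t (aeval x a) := by
  obtain ⟨n, c, hc, rfl⟩ := WfDvdMonoid.max_power_factor ha hirr
  rw [map_mul, map_pow]
  exact (hπt.pow ht n).mul ht (.of_unit (aeval_mem_adjoin x y c)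
    (Place.valuation_aeval_eq_one hx hirr hπ hc))

theorem valuation_right_eq_one {P : Place K F} (hx : x ∈ P.ring) {π : K[X]}
    (hirr : Irreducible π) (hπ : P.ring.valuation (aeval x π) < 1) (hf : ¬ π ∣ f) :
    P.ring.valuation y = 1 := by
  refine (pow_left_inj₀ zero_le zero_le _root_.two_ne_zero).1 ?_
  rw [← map_pow, h.equation, one_pow]
  exact Place.valuation_aeval_eq_one hx hirr hπ hf

/-- Split and inert primes are handled together. With a, b coprime, a + by and a - by cannot both
lie in the maximal ideal: then so would 2a and by, and since 2 and y are units, π would divide both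
a and b. If a + by is not a unit, it is therefore its norm, a polynomial in x, divided by a unit. -/
theorem isLocalFraction_of_not_dvd {P : Place K F} (hx : x ∈ P.ring) {π : K[X]}
    (hirr : Irreducible π) (hπ : P.ring.valuation (aeval x π) < 1) (hf : ¬ π ∣ f)
    {z : F} (hz : z ≠ 0) : IsLocalFraction (Algebra.adjoin K {x, y}) P (aeval x π) z := by
  have ht := h.aeval_ne_zero hirr.ne_zero
  have hpoly : ∀ {a : K[X]}, a ≠ 0 →
      IsLocalFraction (Algebra.adjoin K {x, y}) P (aeval x π) (aeval x a) :=
    isLocalFraction_aeval ht hx hirr hπ .self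
  have hvy := h.valuation_right_eq_one hx hirr hπ hf
  refine h.isLocalFraction_of_forall_adjoin ht (fun z hz hz0 => ?_) hz
  obtain ⟨a, b, rfl⟩ := h.exists_eq_of_mem_adjoin hz
  let : GCDMonoid K[X] := UniqueFactorizationMonoid.toGCDMonoid _
  obtain ⟨a', b', ha, hb, hu⟩ := extract_gcd a b
  set g := gcd a b with hg
  have hg0 : g ≠ 0 := by
    intro h0
    rw [ha, hb, h0] at hz0
    simp at hz0
  have key : IsLocalFraction (Algebra.adjoin K {x, y}) P (aeval x π)
      (aeval x a' + aeval x b' * y) := by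
    have hmem : ∀ c : K[X], aeval x a' + aeval x c * y ∈ Algebra.adjoin K {x, y} := fun c =>
      add_mem (aeval_mem_adjoin x y a') (mul_mem (aeval_mem_adjoin x y c) (right_mem_adjoin x y))
    have hle : ∀ c : K[X], P.ring.valuation (aeval x a' + aeval x c * y) ≤ 1 := fun c =>
      (P.ring.valuation_le_one_iff _).2 (h.adjoin_le hx (hmem c))
    rcases (hle b').lt_or_eq with h1 | h1
    · rcases (hle (-b')).lt_or_eq with h2 | h2
      · exfalso
        have hv2 : P.ring.valuation (2 : F) = 1 := by
          have := P.valuation_algebraMap h.two_ne_zero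
          rwa [map_ofNat] at this
        have ha' : P.ring.valuation (aeval x a') < 1 := by
          have h3 := Valuation.map_add_lt _ h1 h2
          rw [map_neg, show aeval x a' + aeval x b' * y + (aeval x a' + -aeval x b' * y) =
            2 * aeval x a' by ring, map_mul, hv2, one_mul] at h3
          exact h3
        have hb' : P.ring.valuation (aeval x b') < 1 := by
          have h3 := Valuation.map_sub_lt _ h1 ha'
          rwa [add_sub_cancel_left, map_mul, hvy, mul_one] at h3
        exact hirr.not_isUnit (isUnit_of_dvd_unit (dvd_gcd
          ((Place.valuation_aeval_lt_one_iff hx hirr hπ).1 ha')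
          ((Place.valuation_aeval_lt_one_iff hx hirr hπ).1 hb')) hu)
      · have hne : aeval x a' + aeval x b' * y ≠ 0 := by
          intro h0
          apply hz0
          rw [ha, hb, map_mul, map_mul, mul_assoc, ← mul_add, h0, mul_zero]
        have hne' : aeval x a' + aeval x (-b') * y ≠ 0 := by
          intro h0
          rw [h0, map_zero] at h2
          exact zero_ne_one h2
        have e : aeval x (a' ^ 2 - b' ^ 2 * f) =
            (aeval x a' + aeval x b' * y) * (aeval x a' + aeval x (-b') * y) := by
          simp only [map_sub, map_mul, map_pow, ← h.equation, map_neg]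
          ring
        rw [← mul_div_cancel_right₀ (aeval x a' + aeval x b' * y) hne', ← e]
        refine (hpoly fun h0 => ?_).div ht (.of_unit (hmem _) h2)
        rw [h0, map_zero] at e
        exact mul_ne_zero hne hne' e.symm
    · exact .of_unit (hmem b') h1
  rw [ha, hb, map_mul, map_mul, mul_assoc, ← mul_add]
  exact (hpoly hg0).mul ht key

theorem valuation_aeval_eq_of_dvd {P : Place K F} (hx : x ∈ P.ring) {π : K[X]}
    (hirr : Irreducible π) (hπ : P.ring.valuation (aeval x π) < 1) (hf : π ∣ f)
    (hsq : ¬ π ^ 2 ∣ f) : P.ring.valuation (aeval x π) = P.ring.valuation y ^ 2 := by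
  obtain ⟨g, rfl⟩ := hf
  have hg : ¬ π ∣ g := by
    rintro ⟨k, rfl⟩
    exact hsq ⟨k, by ring⟩
  rw [← map_pow, h.equation, map_mul, map_mul, Place.valuation_aeval_eq_one hx hirr hπ hg, mul_one]

theorem valuation_right_lt_one {P : Place K F} (hx : x ∈ P.ring) {π : K[X]}
    (hπ : P.ring.valuation (aeval x π) < 1) (hf : π ∣ f) : P.ring.valuation y < 1 := by
  refine (pow_lt_one_iff (n := 2) (by simp)).1 ?_
  rw [← map_pow, h.equation]
  exact Place.valuation_aeval_lt_one_of_dvd hx hπ hf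

theorem right_ne_zero_of_not_sq_dvd {π : K[X]} (hsq : ¬ π ^ 2 ∣ f) : y ≠ 0 := by
  rintro rfl
  have h0 : f ≠ 0 := by rintro rfl; simp at hsq
  exact h.aeval_ne_zero h0 (by rw [← h.equation]; simp)

/-- Here π is y² times a unit, so nonzero polynomials in x have even order in y. The terms a and by
thus have orders of different parity, and one of them dominates. -/
theorem isLocalFraction_of_dvd {P : Place K F} (hx : x ∈ P.ring) {π : K[X]}
    (hirr : Irreducible π) (hπ : P.ring.valuation (aeval x π) < 1) (hf : π ∣ f)
    (hsq : ¬ π ^ 2 ∣ f) {z : F} (hz : z ≠ 0) :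
    IsLocalFraction (Algebra.adjoin K {x, y}) P y z := by
  have hy := h.right_ne_zero_of_not_sq_dvd hsq
  have hylt := h.valuation_right_lt_one hx hπ hf
  have hypos : 0 < P.ring.valuation y := by simpa [zero_lt_iff] using hy
  have hπy := h.valuation_aeval_eq_of_dvd hx hirr hπ hf hsq
  have hpoly : ∀ {a : K[X]}, a ≠ 0 →
      IsLocalFraction (Algebra.adjoin K {x, y}) P y (aeval x a) := by
    refine isLocalFraction_aeval hy hx hirr hπ ?_
    obtain ⟨g, rfl⟩ := hf
    have hg : ¬ π ∣ g := by
      rintro ⟨k, rfl⟩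
      exact hsq ⟨k, by ring⟩
    have hg0 : aeval x g ≠ 0 := h.aeval_ne_zero (by rintro rfl; simp at hg)
    rw [← mul_div_cancel_right₀ (aeval x π) hg0, ← map_mul, ← h.equation]
    exact (IsLocalFraction.self.pow hy 2).div hy (.of_unit (aeval_mem_adjoin x y g)
      (Place.valuation_aeval_eq_one hx hirr hπ hg))
  have heven : ∀ {a : K[X]}, a ≠ 0 →
      ∃ n : ℕ, P.ring.valuation (aeval x a) = P.ring.valuation y ^ (2 * n) := by
    intro a ha
    obtain ⟨n, c, hc, rfl⟩ := WfDvdMonoid.max_power_factor ha hirr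
    refine ⟨n, ?_⟩
    rw [map_mul, map_pow, map_mul, map_pow, Place.valuation_aeval_eq_one hx hirr hπ hc, hπy,
      mul_one, pow_mul]
  refine h.isLocalFraction_of_forall_adjoin hy (fun z hz hz0 => ?_) hz
  obtain ⟨a, b, rfl⟩ := h.exists_eq_of_mem_adjoin hz
  by_cases ha : a = 0
  · subst ha
    have hb : b ≠ 0 := by rintro rfl; simp at hz0
    rw [map_zero, zero_add]
    exact (hpoly hb).mul hy .self
  by_cases hb : b = 0
  · subst hb
    rw [map_zero, zero_mul, add_zero]
    exact hpoly ha
  have hne : P.ring.valuation (aeval x a) ≠ P.ring.valuation (aeval x b * y) := by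
    obtain ⟨m, hm⟩ := heven ha
    obtain ⟨n, hn⟩ := heven hb
    rw [map_mul, hm, hn, ← pow_succ]
    intro e
    have := (pow_right_injective₀ hypos hylt.ne) e
    omega
  rcases hne.lt_or_gt with hlt | hlt
  · rw [add_comm]
    exact .add_of_lt (right_mem_adjoin x y) hy hylt ((hpoly hb).mul hy .self) (hpoly ha) hlt
  · exact .add_of_lt (right_mem_adjoin x y) hy hylt (hpoly ha) ((hpoly hb).mul hy .self) hlt

theorem exists_isLocalFraction {P : Place K F} (hx : x ∈ P.ring) {π : K[X]}
    (hirr : Irreducible π) (hπ : P.ring.valuation (aeval x π) < 1) (hsq : ¬ π ^ 2 ∣ f) :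
    ∃ t ∈ Algebra.adjoin K {x, y}, t ≠ 0 ∧ P.ring.valuation t < 1 ∧
      ∀ z : F, z ≠ 0 → IsLocalFraction (Algebra.adjoin K {x, y}) P t z := by
  by_cases hf : π ∣ f
  · exact ⟨y, right_mem_adjoin x y, h.right_ne_zero_of_not_sq_dvd hsq,
      h.valuation_right_lt_one hx hπ hf, fun z hz => h.isLocalFraction_of_dvd hx hirr hπ hf hsq hz⟩
  · exact ⟨aeval x π, aeval_mem_adjoin x y π, h.aeval_ne_zero hirr.ne_zero, hπ,
      fun z hz => h.isLocalFraction_of_not_dvd hx hirr hπ hf hz⟩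

end IsQuadraticModel

/-! ### Discrete places and their order function. -/

namespace Place

variable {P : Place K F} {t z w : F} {n : ℤ}

/-- Every nonzero element has the value of a power of `t`, and `t` has value less than one. -/
structure IsUniformizer (P : Place K F) (t : F) : Prop where
  ne_zero : t ≠ 0
  lt_one : P.ring.valuation t < 1
  exists_eq : ∀ z : F, z ≠ 0 → ∃ n : ℤ, P.ring.valuation z = P.ring.valuation t ^ n

theorem IsUniformizer.pos (h : P.IsUniformizer t) : 0 < P.ring.valuation t := by
  simpa [zero_lt_iff] using h.ne_zero

theorem IsUniformizer.le_of_lt_one (h : P.IsUniformizer t) (hz : P.ring.valuation z < 1) :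
    P.ring.valuation z ≤ P.ring.valuation t := by
  by_cases hz0 : z = 0
  · simp [hz0]
  obtain ⟨n, hn⟩ := h.exists_eq z hz0
  rw [hn] at hz ⊢
  rw [← zpow_zero (P.ring.valuation t), zpow_lt_zpow_iff_right_of_lt_one₀ h.pos h.lt_one] at hz
  conv_rhs => rw [← zpow_one (P.ring.valuation t)]
  rw [zpow_le_zpow_iff_right_of_lt_one₀ h.pos h.lt_one]
  omega

theorem mem_of_valuation_le {z w : F}
    (h : P.ring.valuation z ≤ P.ring.valuation w) : z / w ∈ P.ring := by
  rw [← P.ring.valuation_le_one_iff, map_div₀]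
  exact div_le_one_of_le₀ h zero_le

theorem IsUniformizer.hasOrder_iff (h : P.IsUniformizer t) :
    P.HasOrder z n ↔ P.ring.valuation z = P.ring.valuation t ^ n := by
  constructor
  · rintro ⟨s, e, hs, rfl⟩
    -- `HasOrder` may use any generator s of the maximal ideal; s and t divide each other, so they
    -- have the same value.
    have hst : P.ring.valuation s = P.ring.valuation t := by
      refine le_antisymm (h.le_of_lt_one ?_) ?_
      · rw [← P.ring.valuation_lt_one_iff, hs]
        exact Ideal.mem_span_singleton_self s
      · have ht : (⟨t, (P.ring.valuation_le_one_iff t).1 h.lt_one.le⟩ : P.ring) ∈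
            Ideal.span {s} := by
          rw [← hs, P.ring.valuation_lt_one_iff]
          exact h.lt_one
        obtain ⟨c, hc⟩ := Ideal.mem_span_singleton.1 ht
        have hc' : t = s * c := congrArg Subtype.val hc
        conv_lhs => rw [hc', map_mul]
        exact mul_le_of_le_one_right zero_le (P.ring.valuation_le_one c)
    rw [map_mul, map_zpow₀, hst, P.ring.valuation_unit, mul_one]
  · intro hz
    have htm : t ∈ P.ring := (P.ring.valuation_le_one_iff t).1 h.lt_one.le
    have hv : P.ring.valuation (z / t ^ n) = 1 := by
      rw [map_div₀, map_zpow₀, hz, div_self (zpow_ne_zero _ h.pos.ne')]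
    have hm : z / t ^ n ∈ P.ring := (P.ring.valuation_le_one_iff _).1 hv.le
    obtain ⟨e, he⟩ := (P.ring.valuation_eq_one_iff ⟨z / t ^ n, hm⟩).2 hv
    refine ⟨⟨t, htm⟩, e, le_antisymm (fun a ha => ?_) ?_, ?_⟩
    · rw [P.ring.valuation_lt_one_iff] at ha
      rw [Ideal.mem_span_singleton]
      refine ⟨⟨(a : F) / t, mem_of_valuation_le (h.le_of_lt_one ha)⟩, ?_⟩
      apply Subtype.ext
      simp [mul_div_cancel₀ _ h.ne_zero]
    · rw [Ideal.span_singleton_le_iff_mem, P.ring.valuation_lt_one_iff]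
      exact h.lt_one
    · rw [he]
      exact (mul_div_cancel₀ _ (zpow_ne_zero _ h.ne_zero)).symm

/-- The valuation of the place is discrete. -/
def IsDiscrete (P : Place K F) : Prop := ∃ t, P.IsUniformizer t

open Classical in
/-- The order of `z` at the place `P`. -/
noncomputable def ord (P : Place K F) (z : F) : ℤ :=
  if h : ∃ n, P.HasOrder z n then h.choose else 0

namespace IsDiscrete

variable (hd : P.IsDiscrete)
include hd

theorem hasOrder_ord (hz : z ≠ 0) : P.HasOrder z (P.ord z) := by
  obtain ⟨t, ht⟩ := hd
  have h : ∃ n, P.HasOrder z n := by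
    obtain ⟨n, hn⟩ := ht.exists_eq z hz
    exact ⟨n, ht.hasOrder_iff.2 hn⟩
  rw [ord, dif_pos h]
  exact h.choose_spec

theorem exists_uniformizer : ∃ t, P.IsUniformizer t ∧
    ∀ z : F, z ≠ 0 → P.ring.valuation z = P.ring.valuation t ^ P.ord z := by
  obtain ⟨t, ht⟩ := id hd
  exact ⟨t, ht, fun z hz => ht.hasOrder_iff.1 (hd.hasOrder_ord hz)⟩

theorem ord_eq (hz : z ≠ 0) (h : P.HasOrder z n) : P.ord z = n := by
  obtain ⟨t, ht, H⟩ := hd.exists_uniformizer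
  have := H z hz
  rw [ht.hasOrder_iff.1 h, zpow_right_inj₀ ht.pos ht.lt_one.ne] at this
  exact this.symm

theorem ord_mul (hz : z ≠ 0) (hw : w ≠ 0) : P.ord (z * w) = P.ord z + P.ord w := by
  obtain ⟨t, ht, H⟩ := hd.exists_uniformizer
  have := H _ (mul_ne_zero hz hw)
  rwa [map_mul, H z hz, H w hw, ← zpow_add₀ ht.pos.ne', zpow_right_inj₀ ht.pos ht.lt_one.ne,
    eq_comm] at this

theorem ord_one : P.ord (1 : F) = 0 := by
  have := hd.ord_mul (one_ne_zero (α := F)) one_ne_zero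
  rw [mul_one] at this
  omega

theorem ord_pow (hz : z ≠ 0) (k : ℕ) : P.ord (z ^ k) = k * P.ord z := by
  induction k with
  | zero => simp [hd.ord_one]
  | succ k ih =>
    rw [pow_succ, hd.ord_mul (pow_ne_zero k hz) hz, ih]
    push_cast
    ring

theorem valuation_le_iff (hz : z ≠ 0) (hw : w ≠ 0) :
    P.ring.valuation z ≤ P.ring.valuation w ↔ P.ord w ≤ P.ord z := by
  obtain ⟨t, ht, H⟩ := hd.exists_uniformizer
  rw [H z hz, H w hw, zpow_le_zpow_iff_right_of_lt_one₀ ht.pos ht.lt_one]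

theorem valuation_lt_iff (hz : z ≠ 0) (hw : w ≠ 0) :
    P.ring.valuation z < P.ring.valuation w ↔ P.ord w < P.ord z := by
  rw [← not_le, hd.valuation_le_iff hw hz, not_le]

theorem ord_nonneg_iff (hz : z ≠ 0) : 0 ≤ P.ord z ↔ z ∈ P.ring := by
  rw [← P.ring.valuation_le_one_iff, ← map_one P.ring.valuation,
    hd.valuation_le_iff hz one_ne_zero, hd.ord_one]

theorem ord_pos_iff (hz : z ≠ 0) : 0 < P.ord z ↔ P.ring.valuation z < 1 := by
  rw [← map_one P.ring.valuation, hd.valuation_lt_iff hz one_ne_zero, hd.ord_one]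

theorem ord_eq_zero_iff (hz : z ≠ 0) : P.ord z = 0 ↔ P.ring.valuation z = 1 := by
  rw [le_antisymm_iff, le_antisymm_iff, ← map_one P.ring.valuation,
    hd.valuation_le_iff hz one_ne_zero, hd.valuation_le_iff one_ne_zero hz, hd.ord_one, and_comm]

theorem ord_eq_of_valuation_eq (hz : z ≠ 0) (hw : w ≠ 0)
    (h : P.ring.valuation z = P.ring.valuation w) : P.ord z = P.ord w :=
  le_antisymm ((hd.valuation_le_iff hw hz).1 h.ge) ((hd.valuation_le_iff hz hw).1 h.le)

theorem ord_neg (hz : z ≠ 0) : P.ord (-z) = P.ord z :=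
  hd.ord_eq_of_valuation_eq (neg_ne_zero.2 hz) hz (Valuation.map_neg _ _)

theorem min_le_ord_add (hz : z ≠ 0) (hw : w ≠ 0) (hzw : z + w ≠ 0) :
    min (P.ord z) (P.ord w) ≤ P.ord (z + w) := by
  rcases le_total (P.ord z) (P.ord w) with h | h
  · rw [min_eq_left h, ← hd.valuation_le_iff hzw hz]
    exact Valuation.map_add_le _ le_rfl ((hd.valuation_le_iff hw hz).2 h)
  · rw [min_eq_right h, ← hd.valuation_le_iff hzw hw]
    exact Valuation.map_add_le _ ((hd.valuation_le_iff hz hw).2 h) le_rfl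

theorem ord_add_of_lt (hz : z ≠ 0) (hw : w ≠ 0) (h : P.ord z < P.ord w) :
    P.ord (z + w) = P.ord z := by
  have h1 := (hd.valuation_lt_iff hw hz).2 h
  have h2 := Valuation.map_add_eq_of_lt_left P.ring.valuation h1
  refine hd.ord_eq_of_valuation_eq (fun h0 => hz ?_) hz h2
  rw [h0, map_zero, eq_comm] at h2
  simpa using h2

/-- The ultrametric inequality applied to adding u * c and to subtracting it again. This is what
makes the local multiplicity of ⟨u, v⟩ depend only on v mod u. -/
theorem min_ord_add_mul {u c : F} (hu : u ≠ 0) (hz : z ≠ 0) (hzu : z + u * c ≠ 0)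
    (hc : c ∈ P.ring) : min (P.ord u) (P.ord (z + u * c)) = min (P.ord u) (P.ord z) := by
  by_cases hc0 : c = 0
  · simp [hc0]
  have h1 := hd.ord_mul hu hc0
  have h2 := (hd.ord_nonneg_iff hc0).2 hc
  have huc := mul_ne_zero hu hc0
  have h3 := hd.min_le_ord_add hz huc hzu
  have h4 := hd.min_le_ord_add hzu (neg_ne_zero.2 huc) (by simpa using hz)
  rw [hd.ord_neg huc, add_neg_cancel_right] at h4
  omega

end IsDiscrete

end Place

/-- The place `P` lies above the prime `π` of `K[x]`, and `y` has the residue of `g(x)`. -/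
structure Place.IsAbove (P : Place K F) (x y : F) (π g : K[X]) : Prop where
  mem : x ∈ P.ring
  lt_one : P.ring.valuation (aeval x π) < 1
  sub_lt_one : P.ring.valuation (y - aeval x g) < 1

/-! ### The place above (π, g): uniqueness, residue field, existence. -/

namespace IsQuadraticModel

variable {f : K[X]} {x y : F} (h : IsQuadraticModel f x y)
include h

theorem isDiscrete {P : Place K F} (hx : x ∈ P.ring) {π : K[X]}
    (hirr : Irreducible π) (hπ : P.ring.valuation (aeval x π) < 1) (hsq : ¬ π ^ 2 ∣ f) :
    P.IsDiscrete := by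
  obtain ⟨t, -, ht, hlt, H⟩ := h.exists_isLocalFraction hx hirr hπ hsq
  exact ⟨t, ht, hlt, fun z hz => (H z hz).exists_valuation_eq⟩

/-- The valuation ring is a localization of K[x, y]; uniqueness and the residue field both rest on
this. -/
theorem exists_eq_div_of_mem {P : Place K F} (hx : x ∈ P.ring) {π : K[X]}
    (hirr : Irreducible π) (hπ : P.ring.valuation (aeval x π) < 1) (hsq : ¬ π ^ 2 ∣ f)
    {z : F} (hz : z ∈ P.ring) : ∃ u ∈ Algebra.adjoin K {x, y}, ∃ w ∈ Algebra.adjoin K {x, y},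
      P.ring.valuation w = 1 ∧ z = u / w := by
  by_cases hz0 : z = 0
  · exact ⟨0, zero_mem _, 1, one_mem _, map_one _, by simp [hz0]⟩
  obtain ⟨t, htA, ht, hlt, H⟩ := h.exists_isLocalFraction hx hirr hπ hsq
  obtain ⟨n, u, hu, w, hw, vu, vw, rfl⟩ := H z hz0
  rw [← P.ring.valuation_le_one_iff] at hz
  simp only [map_mul, map_zpow₀, map_div₀, vu, vw, div_one, mul_one] at hz
  rw [← zpow_zero (P.ring.valuation t), zpow_le_zpow_iff_right_of_lt_one₀
    (by simpa [zero_lt_iff] using ht) hlt] at hz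
  lift n to ℕ using hz
  exact ⟨t ^ n * u, mul_mem (pow_mem htA n) hu, w, hw, vw, by rw [zpow_natCast, mul_div_assoc]⟩

omit h in
theorem valuation_lt_one_iff {P : Place K F} {π g : K[X]} (hirr : Irreducible π)
    (hP : P.IsAbove x y π g) (a b : K[X]) :
    P.ring.valuation (aeval x a + aeval x b * y) < 1 ↔ π ∣ a + b * g := by
  rw [← Place.valuation_aeval_lt_one_iff hP.mem hirr hP.lt_one]
  have h1 := Place.valuation_mul_lt_one_right
    (Place.valuation_aeval_le_one hP.mem b) hP.sub_lt_one
  constructor <;> intro h2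
  · convert! Valuation.map_sub_lt _ h2 h1 using 2
    simp only [map_add, map_mul]
    ring
  · convert! Valuation.map_add_lt _ h2 h1 using 2
    simp only [map_add, map_mul]
    ring

/-- Whether a + by lies in the maximal ideal is decided by π and g alone, so a denominator that is a
unit at P is also one at Q. -/
theorem le_of_isAbove {P Q : Place K F} {π g : K[X]} (hirr : Irreducible π) (hsq : ¬ π ^ 2 ∣ f)
    (hP : P.IsAbove x y π g) (hQ : Q.IsAbove x y π g) : P.ring ≤ Q.ring := by
  intro z hz
  obtain ⟨u, hu, w, hw, vw, rfl⟩ := h.exists_eq_div_of_mem hP.mem hirr hP.lt_one hsq hz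
  have vw' : Q.ring.valuation w = 1 := by
    refine le_antisymm ((Q.ring.valuation_le_one_iff w).2 (h.adjoin_le hQ.mem hw))
      (not_lt.1 fun hlt => vw.not_lt ?_)
    obtain ⟨a, b, rfl⟩ := h.exists_eq_of_mem_adjoin hw
    rw [valuation_lt_one_iff hirr hQ] at hlt
    rwa [valuation_lt_one_iff hirr hP]
  rw [← Q.ring.valuation_le_one_iff, map_div₀, vw', div_one, Q.ring.valuation_le_one_iff]
  exact h.adjoin_le hQ.mem hu

theorem eq_of_isAbove {P Q : Place K F} {π g : K[X]} (hirr : Irreducible π) (hsq : ¬ π ^ 2 ∣ f)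
    (hP : P.IsAbove x y π g) (hQ : Q.IsAbove x y π g) : P = Q := by
  have : P.ring = Q.ring := le_antisymm (h.le_of_isAbove hirr hsq hP hQ)
    (h.le_of_isAbove hirr hsq hQ hP)
  cases P
  cases Q
  simpa using this

/-- In the residue field y becomes g(x), and a denominator prime to π is inverted by Bézout, so
polynomials in x represent every residue. -/
theorem exists_valuation_sub_lt_one {P : Place K F} {π g : K[X]} (hirr : Irreducible π)
    (hsq : ¬ π ^ 2 ∣ f) (hP : P.IsAbove x y π g) {z : F} (hz : z ∈ P.ring) :
    ∃ r : K[X], P.ring.valuation (z - aeval x r) < 1 := by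
  obtain ⟨u, hu, w, hw, vw, rfl⟩ := h.exists_eq_div_of_mem hP.mem hirr hP.lt_one hsq hz
  have hw0 : w ≠ 0 := by rintro rfl; simp at vw
  obtain ⟨a, b, rfl⟩ := h.exists_eq_of_mem_adjoin hu
  obtain ⟨c, d, rfl⟩ := h.exists_eq_of_mem_adjoin hw
  have hdvd : ¬ π ∣ c + d * g := by
    rw [← valuation_lt_one_iff hirr hP, vw]
    exact lt_irrefl _
  obtain ⟨k, e, hke⟩ := hirr.coprime_iff_not_dvd.2 hdvd
  refine ⟨(a + b * g) * e, ?_⟩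
  have hp := fun p => Place.valuation_aeval_le_one (P := P) hP.mem p
  have hsub : (aeval x a + aeval x b * y) / (aeval x c + aeval x d * y) -
      aeval x ((a + b * g) * e) = ((aeval x b - aeval x ((a + b * g) * e * d)) * (y - aeval x g) +
        aeval x ((a + b * g) * k) * aeval x π) / (aeval x c + aeval x d * y) := by
    rw [eq_div_iff hw0, sub_mul, div_mul_cancel₀ _ hw0]
    have := congrArg (aeval x) hke
    simp only [map_add, map_mul, map_one] at this ⊢
    linear_combination (-(aeval x a) - aeval x b * aeval x g) * this
  rw [hsub, map_div₀, vw, div_one]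
  refine Valuation.map_add_lt _ (Place.valuation_mul_lt_one_right ?_ hP.sub_lt_one)
    (Place.valuation_mul_lt_one_right (hp _) hP.lt_one)
  exact Valuation.map_sub_le _ (hp _) (hp _)

theorem degree_eq {P : Place K F} {π g : K[X]} (hirr : Irreducible π)
    (hsq : ¬ π ^ 2 ∣ f) (hP : P.IsAbove x y π g) : P.degree = π.natDegree := by
  have : IsScalarTower K P.ring F := IsScalarTower.of_algebraMap_eq fun c => rfl
  let x' : P.ring := ⟨x, hP.mem⟩
  have hval : ∀ p : K[X], ((aeval x' p : P.ring) : F) = aeval x p := fun p =>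
    (aeval_algebraMap_apply F x' p).symm
  let φ : K[X] →ₐ[K] IsLocalRing.ResidueField P.ring :=
    aeval (algebraMap P.ring (IsLocalRing.ResidueField P.ring) x')
  have hφ : ∀ p, φ p = IsLocalRing.residue P.ring (aeval x' p) := fun p =>
    aeval_algebraMap_apply _ x' p
  have hker : RingHom.ker φ = Ideal.span {π} := by
    ext p
    rw [RingHom.mem_ker, Ideal.mem_span_singleton, hφ, IsLocalRing.residue_eq_zero_iff,
      P.ring.valuation_lt_one_iff, hval, Place.valuation_aeval_lt_one_iff hP.mem hirr hP.lt_one]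
  have hsurj : Function.Surjective φ := by
    intro r
    obtain ⟨z, rfl⟩ := IsLocalRing.residue_surjective r
    obtain ⟨p, hp⟩ := h.exists_valuation_sub_lt_one hirr hsq hP z.2
    refine ⟨p, ?_⟩
    rw [hφ, eq_comm, ← sub_eq_zero, ← map_sub, IsLocalRing.residue_eq_zero_iff,
      P.ring.valuation_lt_one_iff]
    simpa [hval] using hp
  rw [Place.degree, ← (Ideal.quotientKerAlgEquivOfSurjective hsurj).toLinearEquiv.finrank_eq,
    (Ideal.quotientEquivAlgOfEq K hker).toLinearEquiv.finrank_eq, finrank_quotient_span_eq_natDegree]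

/-- The ideal (π, y - g) of K[x, y] is proper, so some valuation ring containing K[x, y] has it
inside its maximal ideal. Independence of 1 and y over K[x] is what allows coefficients to be
compared in the proof of properness. -/
theorem exists_isAbove (hlin : ∀ p q : K[X], aeval x p + aeval x q * y = 0 → p = 0 ∧ q = 0)
    {π g : K[X]} (hirr : Irreducible π) (hdvd : π ∣ g ^ 2 - f) :
    ∃ P : Place K F, P.IsAbove x y π g := by
  set A := (Algebra.adjoin K {x, y}).toSubring with hA
  have hmem : ∀ p : K[X], aeval x p ∈ A := fun p => aeval_mem_adjoin x y p
  have hy : y ∈ A := right_mem_adjoin x y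
  let I : Ideal A := Ideal.span {⟨aeval x π, hmem π⟩, ⟨y - aeval x g, sub_mem hy (hmem g)⟩}
  have hI : I ≠ ⊤ := by
    rw [Ideal.ne_top_iff_one, Ideal.mem_span_pair]
    rintro ⟨⟨r, hr⟩, ⟨s, hs⟩, hrs⟩
    obtain ⟨a, b, rfl⟩ := h.exists_eq_of_mem_adjoin hr
    obtain ⟨c, d, rfl⟩ := h.exists_eq_of_mem_adjoin hs
    have e := congrArg Subtype.val hrs
    simp only [Subring.coe_add, Subring.coe_mul, Subring.coe_one] at e
    obtain ⟨h1, h2⟩ := hlin (a * π - c * g + d * f - 1) (b * π + c - d * g) (by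
      simp only [map_add, map_sub, map_mul, map_one, ← h.equation]
      linear_combination e)
    obtain ⟨k, hk⟩ := hdvd
    -- Substituting y = g in the relation expressing 1, with g² - f = πk, exhibits 1 as a multiple
    -- of π.
    refine hirr.not_isUnit (isUnit_iff_dvd_one.2 ⟨a + b * g - d * k, ?_⟩)
    linear_combination -h1 - g * h2 - d * hk
  obtain ⟨B, hB, hIB⟩ := I.image_subset_nonunits_valuationSubring hI
  have hsub : ∀ z (hz : z ∈ A), (⟨z, hz⟩ : A) ∈ I → B.valuation z < 1 := fun z hz hzI =>
    B.mem_nonunits_iff.1 (hIB ⟨⟨z, hz⟩, hzI, rfl⟩)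
  have hπ := hsub _ (hmem π) (Ideal.subset_span (by simp))
  have hyg := hsub _ (sub_mem hy (hmem g)) (Ideal.subset_span (by simp))
  have hx : x ∈ B := hB (by simpa using hmem X)
  refine ⟨⟨B, fun c => hB (by simpa using hmem (C c)), ⟨x, hx, ?_⟩, ?_⟩, hx, hπ, hyg⟩
  · rintro ⟨c, rfl⟩
    exact h.transcendental (isAlgebraic_algebraMap c)
  · rintro rfl
    have h1 : (aeval x π)⁻¹ ∈ (⊤ : ValuationSubring F) := ValuationSubring.mem_top _
    rw [← ValuationSubring.valuation_le_one_iff, map_inv₀] at h1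
    have h0 := h.aeval_ne_zero hirr.ne_zero
    refine h1.not_gt ((one_lt_inv₀ ?_).2 hπ)
    simpa [zero_lt_iff] using h0

end IsQuadraticModel

/-! ### Orders of π and y at affine places. -/

namespace IsQuadraticModel

variable {f : K[X]} {x y : F} (h : IsQuadraticModel f x y)
include h

theorem isUniformizer_of_dvd {P : Place K F} (hx : x ∈ P.ring) {π : K[X]}
    (hirr : Irreducible π) (hπ : P.ring.valuation (aeval x π) < 1) (hf : π ∣ f)
    (hsq : ¬ π ^ 2 ∣ f) : P.IsUniformizer y :=
  ⟨h.right_ne_zero_of_not_sq_dvd hsq, h.valuation_right_lt_one hx hπ hf,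
    fun _ hz => (h.isLocalFraction_of_dvd hx hirr hπ hf hsq hz).exists_valuation_eq⟩

theorem isUniformizer_of_not_dvd {P : Place K F} (hx : x ∈ P.ring) {π : K[X]}
    (hirr : Irreducible π) (hπ : P.ring.valuation (aeval x π) < 1) (hf : ¬ π ∣ f) :
    P.IsUniformizer (aeval x π) :=
  ⟨h.aeval_ne_zero hirr.ne_zero, hπ,
    fun _ hz => (h.isLocalFraction_of_not_dvd hx hirr hπ hf hz).exists_valuation_eq⟩

theorem ord_aeval_of_not_dvd {P : Place K F} (hx : x ∈ P.ring) {π : K[X]}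
    (hirr : Irreducible π) (hπ : P.ring.valuation (aeval x π) < 1) (hf : ¬ π ∣ f) :
    P.ord (aeval x π) = 1 := by
  have hu := h.isUniformizer_of_not_dvd hx hirr hπ hf
  exact Place.IsDiscrete.ord_eq ⟨_, hu⟩ hu.ne_zero (hu.hasOrder_iff.2 (zpow_one _).symm)

theorem ord_right_of_dvd {P : Place K F} (hx : x ∈ P.ring) {π : K[X]}
    (hirr : Irreducible π) (hπ : P.ring.valuation (aeval x π) < 1) (hf : π ∣ f)
    (hsq : ¬ π ^ 2 ∣ f) : P.ord y = 1 := by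
  have hu := h.isUniformizer_of_dvd hx hirr hπ hf hsq
  exact Place.IsDiscrete.ord_eq ⟨_, hu⟩ hu.ne_zero (hu.hasOrder_iff.2 (zpow_one _).symm)

theorem ord_aeval_of_dvd {P : Place K F} (hx : x ∈ P.ring) {π : K[X]}
    (hirr : Irreducible π) (hπ : P.ring.valuation (aeval x π) < 1) (hf : π ∣ f)
    (hsq : ¬ π ^ 2 ∣ f) : P.ord (aeval x π) = 2 := by
  have hu := h.isUniformizer_of_dvd hx hirr hπ hf hsq
  exact Place.IsDiscrete.ord_eq ⟨_, hu⟩ (h.aeval_ne_zero hirr.ne_zero)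
    (hu.hasOrder_iff.2 (by rw [h.valuation_aeval_eq_of_dvd hx hirr hπ hf hsq]; norm_cast))

end IsQuadraticModel

/-! ### Norms when f is squarefree of degree five. -/

namespace IsFunctionField

variable {f : K[X]} {x y : F} (h : IsFunctionField f x y)
include h

theorem not_sq_dvd {π : K[X]} (hirr : Irreducible π) : ¬ π ^ 2 ∣ f := fun hd =>
  hirr.not_isUnit (h.squarefree π (by rwa [← sq]))

theorem ne_zero : f ≠ 0 := h.squarefree.ne_zero

theorem left_ne_zero : x ≠ 0 := by
  have := h.isQuadraticModel.aeval_ne_zero (p := X) X_ne_zero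
  rwa [aeval_X] at this

/-- The odd degree of f rules out a nonzero solution by parity. -/
theorem eq_zero_of_sq_eq {p q : K[X]} (e : p ^ 2 = q ^ 2 * f) : p = 0 ∧ q = 0 := by
  by_cases hq : q = 0
  · subst hq
    simpa using e
  · have := congrArg natDegree e
    rw [natDegree_pow, natDegree_mul (pow_ne_zero 2 hq) h.ne_zero, natDegree_pow,
      h.natDegree_eq] at this
    omega

theorem eq_zero_of_aeval_add_eq_zero (p q : K[X]) (e : aeval x p + aeval x q * y = 0) :
    p = 0 ∧ q = 0 := by
  apply h.eq_zero_of_sq_eq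
  rw [← sub_eq_zero]
  by_contra hne
  apply h.isQuadraticModel.aeval_ne_zero hne
  simp only [map_sub, map_mul, map_pow, ← h.equation]
  linear_combination (aeval x p - aeval x q * y) * e

theorem sub_aeval_ne_zero (w : K[X]) : y - aeval x w ≠ 0 := by
  intro e
  have := (h.eq_zero_of_aeval_add_eq_zero (-w) 1 (by simp only [map_neg, map_one]; linear_combination e)).2
  exact one_ne_zero this

theorem add_aeval_ne_zero (w : K[X]) : y + aeval x w ≠ 0 := by
  have := h.sub_aeval_ne_zero (-w)
  rwa [map_neg, sub_neg_eq_add] at this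

theorem norm_ne_zero (w : K[X]) : w ^ 2 - f ≠ 0 := by
  intro e
  have := (h.eq_zero_of_sq_eq (p := w) (q := 1) (by linear_combination e)).2
  exact one_ne_zero this

theorem aeval_norm (w : K[X]) : aeval x (w ^ 2 - f) = -((y - aeval x w) * (y + aeval x w)) := by
  rw [map_sub, map_pow, ← h.equation]
  ring

/-! ### The place at infinity -/

theorem aeval_eq_reverse (p : K[X]) : aeval x p = aeval x⁻¹ p.reverse * x ^ p.natDegree := by
  let := invertibleOfNonzero h.left_ne_zero
  have := eval₂_reverse_mul_pow (algebraMap K F) x p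
  rw [invOf_eq_inv] at this
  simp only [aeval_def, this]

/-- Dividing y² = f(x) by x⁶, one power more than deg f, leaves a factor 1/x. The pole of x thus
becomes a ramified place above the prime X, and the affine theory applies to it. -/
theorem isQuadraticModel_inv : IsQuadraticModel (X * f.reverse) x⁻¹ (y / x ^ 3) where
  two_ne_zero := h.two_ne_zero
  transcendental := fun ha => h.transcendental (by simpa using ha.inv)
  equation := by
    have hx := h.left_ne_zero
    have := h.aeval_eq_reverse f
    rw [h.natDegree_eq, ← h.equation] at this
    rw [map_mul, aeval_X, div_pow, this]
    field_simp
  adjoin_eq_top := by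
    have hx := h.left_ne_zero
    rw [eq_top_iff, ← h.adjoin_eq_top, IntermediateField.adjoin_le_iff]
    have h1 : x ∈ IntermediateField.adjoin K {x⁻¹, y / x ^ 3} := by
      rw [← inv_inv x]
      exact inv_mem (IntermediateField.subset_adjoin _ _ (by simp))
    rintro z (rfl | rfl)
    · exact h1
    · have h2 := mul_mem (IntermediateField.subset_adjoin K {x⁻¹, z / x ^ 3}
        (show z / x ^ 3 ∈ _ by simp)) (pow_mem h1 3)
      rwa [div_mul_cancel₀ _ (pow_ne_zero 3 hx)] at h2

omit h in
theorem not_X_dvd_reverse {p : K[X]} (hp : p ≠ 0) : ¬ X ∣ p.reverse := by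
  rw [X_dvd_iff, coeff_zero_reverse]
  exact leadingCoeff_ne_zero.2 hp

theorem not_X_sq_dvd : ¬ X ^ 2 ∣ X * f.reverse := by
  rw [sq, mul_dvd_mul_iff_left X_ne_zero]
  exact not_X_dvd_reverse h.ne_zero

variable {infty : Place K F} (hinfty : infty.IsInfinite x)
include hinfty

theorem isAbove_infty : infty.IsAbove x⁻¹ (y / x ^ 3) X 0 := by
  have hlt : infty.ring.valuation x⁻¹ < 1 := by
    rw [← ValuationSubring.mem_nonunits_iff, ValuationSubring.inv_mem_nonunits_iff]
    exact Or.inr hinfty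
  have hmem := (infty.ring.valuation_le_one_iff _).1 hlt.le
  refine ⟨hmem, by rwa [aeval_X], ?_⟩
  rw [map_zero, sub_zero]
  exact h.isQuadraticModel_inv.valuation_right_lt_one hmem (by rwa [aeval_X]) (dvd_mul_right _ _)

theorem infty_unique {P : Place K F} (hP : P.IsInfinite x) : P = infty :=
  h.isQuadraticModel_inv.eq_of_isAbove irreducible_X h.not_X_sq_dvd (h.isAbove_infty hP)
    (h.isAbove_infty hinfty)

theorem mem_of_ne_infty {P : Place K F} (hP : P ≠ infty) : x ∈ P.ring :=
  by_contra fun hx => hP (h.infty_unique hinfty hx)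

theorem degree_infty : infty.degree = 1 := by
  rw [h.isQuadraticModel_inv.degree_eq irreducible_X h.not_X_sq_dvd (h.isAbove_infty hinfty),
    natDegree_X]

theorem isDiscrete_infty : infty.IsDiscrete :=
  have ha := h.isAbove_infty hinfty
  h.isQuadraticModel_inv.isDiscrete ha.mem irreducible_X ha.lt_one h.not_X_sq_dvd

theorem ord_infty_left : infty.ord x = -2 := by
  have hx := h.left_ne_zero
  have hd := h.isDiscrete_infty hinfty
  have ha := h.isAbove_infty hinfty
  have h1 := h.isQuadraticModel_inv.ord_aeval_of_dvd ha.mem irreducible_X ha.lt_one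
    (dvd_mul_right _ _) h.not_X_sq_dvd
  rw [aeval_X] at h1
  have h2 := hd.ord_mul hx (inv_ne_zero hx)
  rw [mul_inv_cancel₀ hx, hd.ord_one] at h2
  omega

theorem ord_infty_right : infty.ord y = -5 := by
  have hx := h.left_ne_zero
  have hd := h.isDiscrete_infty hinfty
  have ha := h.isAbove_infty hinfty
  have h1 := h.isQuadraticModel_inv.ord_right_of_dvd ha.mem irreducible_X ha.lt_one
    (dvd_mul_right _ _) h.not_X_sq_dvd
  have hne := h.isQuadraticModel_inv.right_ne_zero_of_not_sq_dvd h.not_X_sq_dvd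
  have h2 := hd.ord_mul hne (pow_ne_zero 3 hx)
  rw [div_mul_cancel₀ _ (pow_ne_zero 3 hx), h1, hd.ord_pow hx, h.ord_infty_left hinfty] at h2
  simpa using h2

theorem ord_infty_aeval {p : K[X]} (hp : p ≠ 0) :
    infty.ord (aeval x p) = -(2 * (p.natDegree : ℤ)) := by
  have hx := h.left_ne_zero
  have hd := h.isDiscrete_infty hinfty
  have ha := h.isAbove_infty hinfty
  have hr := h.isQuadraticModel_inv.aeval_ne_zero (p := p.reverse) (by simpa using hp)
  rw [h.aeval_eq_reverse, hd.ord_mul hr (pow_ne_zero _ hx), hd.ord_pow hx,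
    h.ord_infty_left hinfty, (hd.ord_eq_zero_iff hr).2
      (Place.valuation_aeval_eq_one ha.mem irreducible_X ha.lt_one (not_X_dvd_reverse hp))]
  ring

/-- The pole of y has odd order 5 and that of w(x) has order 2 deg w, so they never cancel and the
larger one wins. -/
theorem ord_infty_sub_aeval (w : K[X]) (hw : w.natDegree ≤ 3) :
    infty.ord (y - aeval x w) = if w.natDegree = 3 then -6 else -5 := by
  have hd := h.isDiscrete_infty hinfty
  have hy := h.ord_infty_right hinfty
  have hy0 : y ≠ 0 := by simpa using h.sub_aeval_ne_zero 0
  by_cases hw0 : w = 0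
  · simpa [hw0] using hy
  have h1 := h.ord_infty_aeval hinfty hw0
  have hw1 := h.isQuadraticModel.aeval_ne_zero hw0
  have h2 := hd.ord_neg hw1
  rw [sub_eq_add_neg]
  split_ifs with h3
  · rw [add_comm, hd.ord_add_of_lt (neg_ne_zero.2 hw1) hy0 (by omega)]
    omega
  · rw [hd.ord_add_of_lt hy0 (neg_ne_zero.2 hw1) (by omega)]
    omega

omit hinfty

/-! ### The affine places -/

theorem isDiscrete (P : Place K F) : P.IsDiscrete := by
  by_cases hx : x ∈ P.ring
  · obtain ⟨π, -, hirr, hπ⟩ := h.isQuadraticModel.exists_irreducible hx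
    exact h.isQuadraticModel.isDiscrete hx hirr hπ (h.not_sq_dvd hirr)
  · exact h.isDiscrete_infty hx

theorem ord_aeval_pow_mul {P : Place K F} (hx : x ∈ P.ring) {π : K[X]} (hirr : Irreducible π)
    (hπ : P.ring.valuation (aeval x π) < 1) (n : ℕ) {c : K[X]} (hc : ¬ π ∣ c) :
    P.ord (aeval x (π ^ n * c)) = n * P.ord (aeval x π) := by
  have hd := h.isDiscrete P
  have h0 := h.isQuadraticModel.aeval_ne_zero hirr.ne_zero
  have hc0 : c ≠ 0 := by rintro rfl; simp at hc
  have hc1 := h.isQuadraticModel.aeval_ne_zero hc0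
  rw [map_mul, map_pow, hd.ord_mul (pow_ne_zero n h0) hc1, hd.ord_pow h0,
    (hd.ord_eq_zero_iff hc1).2 (Place.valuation_aeval_eq_one hx hirr hπ hc), add_zero]

theorem ord_aeval_nonneg {P : Place K F} (hx : x ∈ P.ring) {p : K[X]} (hp : p ≠ 0) :
    0 ≤ P.ord (aeval x p) :=
  ((h.isDiscrete P).ord_nonneg_iff (h.isQuadraticModel.aeval_ne_zero hp)).2 (Place.aeval_mem hx p)

theorem ord_aeval_mul (P : Place K F) {p q : K[X]} (hp : p ≠ 0) (hq : q ≠ 0) :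
    P.ord (aeval x (p * q)) = P.ord (aeval x p) + P.ord (aeval x q) := by
  rw [map_mul, (h.isDiscrete P).ord_mul (h.isQuadraticModel.aeval_ne_zero hp)
    (h.isQuadraticModel.aeval_ne_zero hq)]

theorem ord_aeval_le_of_dvd {P : Place K F} (hx : x ∈ P.ring) {p q : K[X]} (hq : q ≠ 0)
    (hd : p ∣ q) : P.ord (aeval x p) ≤ P.ord (aeval x q) := by
  obtain ⟨r, rfl⟩ := hd
  have hp := left_ne_zero_of_mul hq
  have hr := right_ne_zero_of_mul hq
  rw [h.ord_aeval_mul P hp hr]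
  have := h.ord_aeval_nonneg hx hr
  omega

theorem ord_sub_add_ord_add (P : Place K F) (w : K[X]) :
    P.ord (y - aeval x w) + P.ord (y + aeval x w) = P.ord (aeval x (w ^ 2 - f)) := by
  have hd := h.isDiscrete P
  have h1 := h.sub_aeval_ne_zero w
  have h2 := h.add_aeval_ne_zero w
  rw [h.aeval_norm, hd.ord_neg (mul_ne_zero h1 h2), hd.ord_mul h1 h2]

theorem valuation_two (P : Place K F) : P.ring.valuation (2 : F) = 1 := by
  have := P.valuation_algebraMap h.two_ne_zero
  rwa [map_ofNat] at this

/-- The orders of `y - w(x)` and `y + w(x)` at an affine place. -/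
theorem ord_sub_ord_add_cases {P : Place K F} (hx : x ∈ P.ring) (w : K[X]) :
    (P.ord (y + aeval x w) = 0 ∧ P.ord (y - aeval x w) = P.ord (aeval x (w ^ 2 - f))) ∨
    (P.ord (y - aeval x w) = 0 ∧ P.ord (y + aeval x w) = P.ord (aeval x (w ^ 2 - f))) ∨
    (P.ord (y - aeval x w) = 1 ∧ P.ord (y + aeval x w) = 1 ∧
      P.ord (aeval x (w ^ 2 - f)) = 2 ∧ P.ring.valuation y < 1 ∧
      ∀ p : K[X], p ≠ 0 → ∃ k : ℕ, P.ord (aeval x p) = 2 * k) := by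
  have hd := h.isDiscrete P
  have hN := h.ord_sub_add_ord_add P w
  have h1 := h.sub_aeval_ne_zero w
  have h2 := h.add_aeval_ne_zero w
  have hy := h.isQuadraticModel.right_mem_ring hx
  have hw := Place.aeval_mem hx w
  have hn1 := (hd.ord_nonneg_iff h1).2 (sub_mem hy hw)
  have hn2 := (hd.ord_nonneg_iff h2).2 (add_mem hy hw)
  rcases hn2.eq_or_lt with e2 | e2
  · exact Or.inl ⟨e2.symm, by omega⟩
  rcases hn1.eq_or_lt with e1 | e1
  · exact Or.inr (Or.inl ⟨e1.symm, by omega⟩)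
  refine Or.inr (Or.inr ?_)
  rw [hd.ord_pos_iff h2] at e2
  rw [hd.ord_pos_iff h1] at e1
  -- If neither factor is a unit, then y and w(x) both lie in the maximal ideal. The place is
  -- therefore ramified with uniformizer y, and a nonzero w(x) has positive even order, too large to
  -- disturb the order 1 of y.
  have hylt : P.ring.valuation y < 1 := by
    have h3 := Valuation.map_add_lt _ e1 e2
    rwa [show y - aeval x w + (y + aeval x w) = 2 * y by ring, map_mul, h.valuation_two,
      one_mul] at h3
  have hwlt : P.ring.valuation (aeval x w) < 1 := by
    have h3 := Valuation.map_sub_lt _ e2 hylt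
    rwa [add_sub_cancel_left] at h3
  obtain ⟨π, -, hirr, hπ⟩ := h.isQuadraticModel.exists_irreducible hx
  have hf : π ∣ f := by
    by_contra hf
    exact hylt.ne (h.isQuadraticModel.valuation_right_eq_one hx hirr hπ hf)
  have hyord := h.isQuadraticModel.ord_right_of_dvd hx hirr hπ hf (h.not_sq_dvd hirr)
  have heven : ∀ p : K[X], p ≠ 0 → ∃ k : ℕ, P.ord (aeval x p) = 2 * k := by
    intro p hp
    obtain ⟨n, c, hc, rfl⟩ := WfDvdMonoid.max_power_factor hp hirr
    refine ⟨n, ?_⟩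
    rw [h.ord_aeval_pow_mul hx hirr hπ n hc,
      h.isQuadraticModel.ord_aeval_of_dvd hx hirr hπ hf (h.not_sq_dvd hirr), mul_comm]
  have hy0 : y ≠ 0 := by simpa using h.sub_aeval_ne_zero 0
  have key : P.ord (y - aeval x w) = 1 ∧ P.ord (y + aeval x w) = 1 := by
    by_cases hw0 : w = 0
    · simpa [hw0] using hyord
    have hw1 := h.isQuadraticModel.aeval_ne_zero hw0
    obtain ⟨k, hk⟩ := heven w hw0
    have hpos := (hd.ord_pos_iff hw1).2 hwlt
    have hneg := hd.ord_neg hw1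
    rw [sub_eq_add_neg, hd.ord_add_of_lt hy0 (neg_ne_zero.2 hw1) (by omega),
      hd.ord_add_of_lt hy0 hw1 (by omega)]
    exact ⟨hyord, hyord⟩
  exact ⟨key.1, key.2, by omega, hylt, heven⟩

end IsFunctionField

theorem mem_degreeZero_iff {D : Divisor K F} : D ∈ degreeZero K F ↔ divisorDegree K F D = 0 :=
  Iff.rfl

theorem divisorDegree_single (P : Place K F) (n : ℤ) :
    divisorDegree K F (Finsupp.single P n) = n * P.degree := by
  simp [divisorDegree]

theorem Place.IsAt.isAbove {P : Place K F} {x y : F} {a b : K} (hP : P.IsAt x y a b) :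
    P.IsAbove x y (X - C a) (C b) := by
  obtain ⟨h1, h2⟩ := hP
  rw [ValuationSubring.mem_nonunits_iff] at h1 h2
  refine ⟨?_, by simpa using h1, by simpa using h2⟩
  rw [← sub_add_cancel x (algebraMap K F a)]
  exact add_mem ((P.ring.valuation_le_one_iff _).1 h1.le) (P.algebraMap_mem a)

/-! ### Mumford representations and the divisors they define. -/

namespace IsFunctionField

variable {f : K[X]} {x y : F} (h : IsFunctionField f x y)
include h

theorem dvd_norm_of_isAbove {P : Place K F} {π g : K[X]} (hirr : Irreducible π)
    (hP : P.IsAbove x y π g) : π ∣ g ^ 2 - f := by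
  rw [← Place.valuation_aeval_lt_one_iff hP.mem hirr hP.lt_one, h.aeval_norm, Valuation.map_neg]
  exact Place.valuation_mul_lt_one_left hP.sub_lt_one ((P.ring.valuation_le_one_iff _).2
    (add_mem (h.isQuadraticModel.right_mem_ring hP.mem) (Place.aeval_mem hP.mem g)))

theorem eval_eq_sq {P : Place K F} {a b : K} (hP : P.IsAt x y a b) : f.eval a = b ^ 2 := by
  have := h.dvd_norm_of_isAbove (irreducible_X_sub_C a) hP.isAbove
  rw [dvd_iff_isRoot, IsRoot, eval_sub, eval_pow, eval_C, sub_eq_zero] at this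
  exact this.symm

/-- An unramified place has ord π = 1. At a ramified one ord π = 2, but y - g and y + g both vanish,
hence both to order exactly 1. -/
theorem min_ord_eq_one {P : Place K F} {π g : K[X]} (hirr : Irreducible π)
    (hP : P.IsAbove x y π g) :
    min (P.ord (aeval x π)) (P.ord (y - aeval x g)) = 1 := by
  have hd := h.isDiscrete P
  have h1 := h.sub_aeval_ne_zero g
  have hpos := (hd.ord_pos_iff h1).2 hP.sub_lt_one
  by_cases hf : π ∣ f
  · have h2 := h.isQuadraticModel.ord_aeval_of_dvd hP.mem hirr hP.lt_one hf (h.not_sq_dvd hirr)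
    rcases h.ord_sub_ord_add_cases hP.mem g with h3 | h3 | h3
    · exfalso
      have hylt := h.isQuadraticModel.valuation_right_lt_one hP.mem hP.lt_one hf
      have h4 : P.ring.valuation (y + aeval x g) < 1 := by
        rw [show y + aeval x g = 2 * y - (y - aeval x g) by ring]
        refine Valuation.map_sub_lt _ ?_ hP.sub_lt_one
        rwa [map_mul, h.valuation_two, one_mul]
      rw [← hd.ord_pos_iff (h.add_aeval_ne_zero g)] at h4
      omega
    · omega
    · omega
  · have h2 := h.isQuadraticModel.ord_aeval_of_not_dvd hP.mem hirr hP.lt_one hf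
    omega

/-- If y + v is a unit, y - v has at least the order of u * u'; if y - v is a unit, all minima are
0. In the ramified case u and u' have even orders with sum at most 2, so at most one of them
vanishes at P, and both sides equal 0 or 1. -/
theorem min_ord_mul {P : Place K F} (hx : x ∈ P.ring) {u u' v : K[X]}
    (hdvd : u * u' ∣ v ^ 2 - f) :
    min (P.ord (aeval x (u * u'))) (P.ord (y - aeval x v)) =
      min (P.ord (aeval x u)) (P.ord (y - aeval x v)) +
      min (P.ord (aeval x u')) (P.ord (y - aeval x v)) := by
  have hN := h.norm_ne_zero v
  have h0 := ne_zero_of_dvd_ne_zero hN hdvd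
  have hu := left_ne_zero_of_mul h0
  have hu' := right_ne_zero_of_mul h0
  have h1 := h.ord_aeval_le_of_dvd hx hN hdvd
  have h2 := h.ord_aeval_nonneg hx hu
  have h3 := h.ord_aeval_nonneg hx hu'
  rw [h.ord_aeval_mul P hu hu'] at h1 ⊢
  rcases h.ord_sub_ord_add_cases hx v with h4 | h4 | ⟨h4, -, h5, -, h6⟩
  · omega
  · omega
  · obtain ⟨k, hk⟩ := h6 u hu
    obtain ⟨l, hl⟩ := h6 u' hu'
    omega

theorem min_ord_congr {P : Place K F} (hx : x ∈ P.ring) {u v w : K[X]} (hu : u ≠ 0)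
    (hdvd : u ∣ v - w) : min (P.ord (aeval x u)) (P.ord (y - aeval x w)) =
      min (P.ord (aeval x u)) (P.ord (y - aeval x v)) := by
  obtain ⟨c, hc⟩ := hdvd
  have e : y - aeval x w = y - aeval x v + aeval x u * aeval x c := by
    rw [← map_mul, ← hc, map_sub]
    ring
  have hw := h.sub_aeval_ne_zero w
  rw [e] at hw ⊢
  exact (h.isDiscrete P).min_ord_add_mul (h.isQuadraticModel.aeval_ne_zero hu)
    (h.sub_aeval_ne_zero v) hw (Place.aeval_mem hx c)

/-- The same trichotomy: one minimum is 0 and the other is ord u, or the place is ramified, ord u is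
0 or 2, and the minima are equal. -/
theorem min_ord_add_min_ord {P : Place K F} (hx : x ∈ P.ring) {u v : K[X]}
    (hdvd : u ∣ v ^ 2 - f) :
    min (P.ord (aeval x u)) (P.ord (y - aeval x v)) +
      min (P.ord (aeval x u)) (P.ord (y + aeval x v)) = P.ord (aeval x u) := by
  have hN := h.norm_ne_zero v
  have hu := ne_zero_of_dvd_ne_zero hN hdvd
  have h1 := h.ord_aeval_le_of_dvd hx hN hdvd
  have h2 := h.ord_aeval_nonneg hx hu
  rcases h.ord_sub_ord_add_cases hx v with h4 | h4 | ⟨h4, h7, h5, -, h6⟩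
  · omega
  · omega
  · obtain ⟨k, hk⟩ := h6 u hu
    omega

variable {infty : Place K F} {u v u' v' : K[X]} {D D' : Divisor K F}

theorem apply_of_isMumford (hD : IsMumford f x y infty u v D) {P : Place K F} (hP : P ≠ infty) :
    D P = min (P.ord (aeval x u)) (P.ord (y - aeval x v)) := by
  obtain ⟨m, n, hm, hn, e⟩ := hD.apply_affine P hP
  have hd := h.isDiscrete P
  rw [e, hd.ord_eq (h.isQuadraticModel.aeval_ne_zero hD.monic.ne_zero) hm,
    hd.ord_eq (h.sub_aeval_ne_zero v) hn]

theorem isMumford_of_apply (hu : u.Monic) (hdeg : u.natDegree ≤ 2) (hv : v.degree < u.degree)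
    (hdvd : u ∣ v ^ 2 - f) (h1 : D infty = -(u.natDegree : ℤ))
    (h2 : ∀ P ≠ infty, D P = min (P.ord (aeval x u)) (P.ord (y - aeval x v))) :
    IsMumford f x y infty u v D :=
  ⟨hu, hdeg, hv, hdvd, h1, fun P hP => ⟨_, _,
    (h.isDiscrete P).hasOrder_ord (h.isQuadraticModel.aeval_ne_zero hu.ne_zero),
    (h.isDiscrete P).hasOrder_ord (h.sub_aeval_ne_zero v), h2 P hP⟩⟩

variable (hinfty : infty.IsInfinite x)
include hinfty

omit h in
theorem ne_infty_of_mem {P : Place K F} (hx : x ∈ P.ring) : P ≠ infty := by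
  rintro rfl
  exact hinfty hx

theorem isMumford_of_irreducible {P : Place K F} (hu : u.Monic) (hirr : Irreducible u)
    (hdeg : u.natDegree ≤ 2) (hv : v.degree < u.degree) (hP : P.IsAbove x y u v) :
    IsMumford f x y infty u v
      (Finsupp.single P 1 - Finsupp.single infty (u.natDegree : ℤ)) := by
  have hP' := ne_infty_of_mem hinfty hP.mem
  refine h.isMumford_of_apply hu hdeg hv (h.dvd_norm_of_isAbove hirr hP) ?_ fun Q hQ => ?_
  · simp [hP']
  · have hx := h.mem_of_ne_infty hinfty hQ
    by_cases hPQ : P = Q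
    · subst hPQ
      rw [h.min_ord_eq_one hirr hP]
      simp [hQ.symm]
    · have h0 : (Finsupp.single P 1 - Finsupp.single infty (u.natDegree : ℤ) : Divisor K F) Q = 0 := by
        simp [hPQ, hQ.symm]
      have hd := h.isDiscrete Q
      have hu0 := h.isQuadraticModel.aeval_ne_zero hu.ne_zero
      have hv0 := h.sub_aeval_ne_zero v
      have h1 := h.ord_aeval_nonneg hx hu.ne_zero
      have h2 := (hd.ord_nonneg_iff hv0).2 (sub_mem (h.isQuadraticModel.right_mem_ring hx)
        (Place.aeval_mem hx v))
      rw [h0]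
      by_contra hne
      exact hPQ (h.isQuadraticModel.eq_of_isAbove hirr (h.not_sq_dvd hirr) hP
        ⟨hx, (hd.ord_pos_iff hu0).1 (by omega), (hd.ord_pos_iff hv0).1 (by omega)⟩)

/-- Composition without reduction. The divisibility by the full product u * u' is essential when the
factors share a root. -/
theorem isMumford_mul {w : K[X]} (hD : IsMumford f x y infty u v D)
    (hD' : IsMumford f x y infty u' v' D') (hdeg : (u * u').natDegree ≤ 2)
    (hw : w.degree < (u * u').degree) (hdvd : u * u' ∣ w ^ 2 - f) (h1 : u ∣ w - v)
    (h2 : u' ∣ w - v') : IsMumford f x y infty (u * u') w (D + D') := by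
  refine h.isMumford_of_apply (hD.monic.mul hD'.monic) hdeg hw hdvd ?_ fun P hP => ?_
  · rw [Finsupp.add_apply, hD.apply_infty, hD'.apply_infty, hD.monic.natDegree_mul hD'.monic]
    push_cast
    ring
  · have hx := h.mem_of_ne_infty hinfty hP
    rw [h.min_ord_mul hx hdvd, Finsupp.add_apply, h.apply_of_isMumford hD hP,
      h.apply_of_isMumford hD' hP, h.min_ord_congr hx hD.monic.ne_zero h1,
      h.min_ord_congr hx hD'.monic.ne_zero h2]

theorem degree_single_sub_single {P : Place K F} (hirr : Irreducible u) (hP : P.IsAbove x y u v) :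
    (Finsupp.single P 1 - Finsupp.single infty (u.natDegree : ℤ) : Divisor K F) ∈
      degreeZero K F := by
  rw [mem_degreeZero_iff, map_sub, divisorDegree_single, divisorDegree_single,
    h.degree_infty hinfty, h.isQuadraticModel.degree_eq hirr (h.not_sq_dvd hirr) hP]
  ring

theorem exists_isMumford_of_irreducible (hu : u.Monic) (hirr : Irreducible u)
    (hdeg : u.natDegree ≤ 2) (hv : v.degree < u.degree) (hdvd : u ∣ v ^ 2 - f) :
    ∃ D, IsMumford f x y infty u v D ∧ D ∈ degreeZero K F := by
  obtain ⟨P, hP⟩ := h.isQuadraticModel.exists_isAbove h.eq_zero_of_aeval_add_eq_zero hirr hdvd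
  exact ⟨_, h.isMumford_of_irreducible hinfty hu hirr hdeg hv hP,
    h.degree_single_sub_single hinfty hirr hP⟩

/-- Every pair of the shape of a Mumford representation represents a divisor of degree zero. -/
theorem exists_isMumford (hu : u.Monic) (hdeg0 : u.natDegree ≠ 0) (hdeg : u.natDegree ≤ 2)
    (hv : v.degree < u.degree) (hdvd : u ∣ v ^ 2 - f) :
    ∃ D, IsMumford f x y infty u v D ∧ D ∈ degreeZero K F := by
  by_cases hirr : Irreducible u
  · exact h.exists_isMumford_of_irreducible hinfty hu hirr hdeg hv hdvd
  -- A reducible u here is a product of two monic linear factors, possibly equal; its divisor is the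
  -- sum of those of two rational points.
  obtain ⟨a, ha⟩ : ∃ a, u.IsRoot a := by
    by_contra! hno
    exact hirr (irreducible_of_degree_le_three_of_not_isRoot
      (Finset.mem_Icc.2 ⟨by omega, by omega⟩) hno)
  obtain ⟨q, rfl⟩ := dvd_iff_isRoot.2 ha
  have hq : q.Monic := (monic_X_sub_C a).of_mul_monic_left hu
  have hq1 : q.natDegree = 1 := by
    rw [(monic_X_sub_C a).natDegree_mul hq, natDegree_X_sub_C] at hdeg
    by_contra hne
    have h0 : q.natDegree = 0 := by omega
    rw [hq.natDegree_eq_zero.1 h0, mul_one] at hirr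
    exact hirr (irreducible_X_sub_C a)
  obtain ⟨b, rfl⟩ : ∃ b, q = X - C b := ⟨-q.coeff 0, by
    conv_lhs => rw [eq_X_add_C_of_natDegree_le_one hq1.le]
    have : q.coeff 1 = 1 := by rw [← hq1]; exact hq
    simp [this]⟩
  have key : ∀ c : K, X - C c ∣ v ^ 2 - f →
      ∃ D, IsMumford f x y infty (X - C c) (C (v.eval c)) D ∧ D ∈ degreeZero K F := by
    intro c hc
    refine h.exists_isMumford_of_irreducible hinfty (monic_X_sub_C c) (irreducible_X_sub_C c)
      (by simp) (by rw [degree_X_sub_C]; exact degree_C_le.trans_lt one_pos) ?_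
    rw [dvd_iff_isRoot] at hc ⊢
    simpa using hc
  obtain ⟨D, hD, hD0⟩ := key a ((dvd_mul_right _ _).trans hdvd)
  obtain ⟨D', hD', hD0'⟩ := key b ((dvd_mul_left _ _).trans hdvd)
  exact ⟨D + D', h.isMumford_mul hinfty hD hD' hdeg hv hdvd X_sub_C_dvd_sub_C_eval
    X_sub_C_dvd_sub_C_eval, add_mem hD0 hD0'⟩

/-- The divisor of `y - L(x)` is the sum of the divisors of the factors of `L² - f`. -/
theorem isDivisorOf_sub_aeval {L u'' v'' : K[X]} {D'' : Divisor K F} {c : K} (hc : c ≠ 0)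
    (hN : L ^ 2 - f = C c * (u * u' * u'')) (hL : L.natDegree ≤ 3)
    (hdeg : u.natDegree + u'.natDegree + u''.natDegree = if L.natDegree = 3 then 6 else 5)
    (hD : IsMumford f x y infty u v D) (hD' : IsMumford f x y infty u' v' D')
    (hD'' : IsMumford f x y infty u'' v'' D'') (h1 : u ∣ L - v) (h2 : u' ∣ L - v')
    (h3 : u'' ∣ L - v'') : IsDivisorOf (D + D' + D'') (y - aeval x L) := by
  have hL0 := h.sub_aeval_ne_zero L
  refine ⟨hL0, fun P => ?_⟩
  have hd := h.isDiscrete P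
  convert! hd.hasOrder_ord hL0 using 1
  rw [Finsupp.add_apply, Finsupp.add_apply]
  by_cases hP : P = infty
  · subst hP
    rw [hD.apply_infty, hD'.apply_infty, hD''.apply_infty, h.ord_infty_sub_aeval hinfty L hL]
    split_ifs at hdeg ⊢ <;> omega
  · have hx := h.mem_of_ne_infty hinfty hP
    have hdvd : u * u' * u'' ∣ L ^ 2 - f := hN ▸ dvd_mul_left _ _
    rw [h.apply_of_isMumford hD hP, h.apply_of_isMumford hD' hP, h.apply_of_isMumford hD'' hP,
      h.min_ord_congr hx hD.monic.ne_zero h1, h.min_ord_congr hx hD'.monic.ne_zero h2,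
      h.min_ord_congr hx hD''.monic.ne_zero h3,
      ← h.min_ord_mul hx ((dvd_mul_right _ _).trans hdvd), ← h.min_ord_mul hx hdvd]
    -- The product has the order of the norm of y - L, which is at least that of y - L because y + L
    -- is integral at P.
    refine min_eq_right ?_
    have hu := ((hD.monic.mul hD'.monic).mul hD''.monic).ne_zero
    have hle : P.ord (aeval x (L ^ 2 - f)) = P.ord (aeval x (u * u' * u'')) := by
      rw [hN, h.ord_aeval_mul P (C_ne_zero.2 hc) hu, aeval_C,
        (hd.ord_eq_zero_iff ((_root_.map_ne_zero _).2 hc)).2 (P.valuation_algebraMap hc), zero_add]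
    rw [← hle, ← h.ord_sub_add_ord_add]
    have := (hd.ord_nonneg_iff (h.add_aeval_ne_zero L)).2
      (add_mem (h.isQuadraticModel.right_mem_ring hx) (Place.aeval_mem hx L))
    omega

/-- The divisors of `⟨u, v⟩` and `⟨u, -v⟩` add up to the divisor of `u(x)`. -/
theorem isDivisorOf_aeval (hD : IsMumford f x y infty u v D)
    (hD' : IsMumford f x y infty u v' D') (hdvd : u ∣ v' + v) :
    IsDivisorOf (D + D') (aeval x u) := by
  have hu0 := h.isQuadraticModel.aeval_ne_zero hD.monic.ne_zero
  refine ⟨hu0, fun P => ?_⟩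
  convert! (h.isDiscrete P).hasOrder_ord hu0 using 1
  rw [Finsupp.add_apply]
  by_cases hP : P = infty
  · subst hP
    rw [hD.apply_infty, hD'.apply_infty, h.ord_infty_aeval hinfty hD.monic.ne_zero]
    ring
  · have hx := h.mem_of_ne_infty hinfty hP
    have := h.min_ord_congr hx hD.monic.ne_zero (v := -v) (w := v')
      (by rw [← dvd_neg]; convert! hdvd using 1; ring)
    rw [h.apply_of_isMumford hD hP, h.apply_of_isMumford hD' hP, this, map_neg, sub_neg_eq_add,
      h.min_ord_add_min_ord hx hD.dvd]

end IsFunctionField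

/-! ### Automorphisms acting on places. -/

namespace Place

variable (P : Place K F) (σ : F ≃ₐ[K] F)

theorem mem_comap_ring {z : F} : z ∈ (P.comap σ).ring ↔ σ z ∈ P.ring := Iff.rfl

theorem valuation_comap_lt_one_iff {z : F} :
    (P.comap σ).ring.valuation z < 1 ↔ P.ring.valuation (σ z) < 1 := by
  rw [← ValuationSubring.mem_nonunits_iff, ← ValuationSubring.mem_nonunits_iff,
    ValuationSubring.mem_nonunits_iff_or, ValuationSubring.mem_nonunits_iff_or, mem_comap_ring,
    map_inv₀, map_eq_zero_iff σ σ.injective]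

theorem valuation_comap_eq_one_iff {z : F} :
    (P.comap σ).ring.valuation z = 1 ↔ P.ring.valuation (σ z) = 1 := by
  rw [eq_iff_le_not_lt, eq_iff_le_not_lt, valuation_comap_lt_one_iff,
    ValuationSubring.valuation_le_one_iff, ValuationSubring.valuation_le_one_iff, mem_comap_ring]

variable {P σ}

theorem IsUniformizer.of_comap {t : F} (h : (P.comap σ).IsUniformizer t) :
    P.IsUniformizer (σ t) := by
  refine ⟨(map_ne_zero_iff σ σ.injective).2 h.ne_zero,
    (P.valuation_comap_lt_one_iff σ).1 h.lt_one, fun z hz => ?_⟩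
  obtain ⟨n, hn⟩ := h.exists_eq (σ.symm z) ((map_ne_zero_iff σ.symm σ.symm.injective).2 hz)
  have h1 : (P.comap σ).ring.valuation (σ.symm z / t ^ n) = 1 := by
    rw [map_div₀, map_zpow₀, hn, div_self (zpow_ne_zero n h.pos.ne')]
  rw [valuation_comap_eq_one_iff, map_div₀, map_zpow₀, AlgEquiv.apply_symm_apply, map_div₀,
    map_zpow₀] at h1
  exact ⟨n, eq_of_div_eq_one h1⟩

theorem ord_comap (hd : (P.comap σ).IsDiscrete) {z : F} (hz : z ≠ 0) :
    (P.comap σ).ord z = P.ord (σ z) := by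
  obtain ⟨t, ht, H⟩ := hd.exists_uniformizer
  have ht' := ht.of_comap
  have h1 : (P.comap σ).ring.valuation (z / t ^ (P.comap σ).ord z) = 1 := by
    rw [map_div₀, map_zpow₀, ← H z hz, div_self (by simpa using hz)]
  rw [valuation_comap_eq_one_iff, map_div₀, map_zpow₀, map_div₀, map_zpow₀] at h1
  exact (IsDiscrete.ord_eq ⟨_, ht'⟩ ((map_ne_zero_iff σ σ.injective).2 hz)
    (ht'.hasOrder_iff.2 (eq_of_div_eq_one h1))).symm

end Place

/-! ### The hyperelliptic involution. -/

namespace IsFunctionField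

variable {f : K[X]} {x y : F} (h : IsFunctionField f x y)
include h

theorem right_notMem_adjoin : y ∉ IntermediateField.adjoin K {x} := by
  rw [IntermediateField.mem_adjoin_simple_iff]
  rintro ⟨r, s, e⟩
  by_cases hs : aeval x s = 0
  · exact h.sub_aeval_ne_zero 0 (by simp [e, hs])
  · have := (h.eq_zero_of_aeval_add_eq_zero (-r) s (by
      rw [e, map_neg, mul_div_cancel₀ _ hs, neg_add_cancel])).2
    exact hs (by simp [this])

/-- The hyperelliptic involution. -/
theorem exists_involution : ∃ ι : F ≃ₐ[K] F, ι x = x ∧ ι y = -y := by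
  let k := IntermediateField.adjoin K {x}
  have hxk : x ∈ k := IntermediateField.subset_adjoin K _ rfl
  have hfk : aeval x f ∈ k := by
    rw [aeval_eq_sum_range]
    exact sum_mem fun i _ => k.smul_mem (pow_mem hxk i)
  let a : k := ⟨aeval x f, hfk⟩
  have ha : algebraMap k F a = y ^ 2 := h.equation.symm
  -- Since y is not in K(x), X² - f(x) is the minimal polynomial of y over K(x). Its other root -y
  -- is the image of y under an endomorphism fixing K(x).
  have hirr : Irreducible (X ^ 2 - C a) := by
    rw [X_pow_sub_C_irreducible_iff_of_prime Nat.prime_two]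
    intro b hb
    have hb' : (b : F) ^ 2 = y ^ 2 := by
      rw [← ha, ← hb]
      rfl
    rcases sq_eq_sq_iff_eq_or_eq_neg.1 hb' with e | e
    · exact h.right_notMem_adjoin (e ▸ b.2)
    · exact h.right_notMem_adjoin (by rw [← neg_neg y, ← e]; exact neg_mem b.2)
  have hmin : X ^ 2 - C a = minpoly k y := minpoly.eq_of_irreducible_of_monic hirr
    (by simp [ha]) (monic_X_pow_sub_C a _root_.two_ne_zero)
  have htop : IntermediateField.adjoin k {y} = ⊤ := by
    have h1 : IntermediateField.adjoin K {x, y} ≤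
        (IntermediateField.adjoin k {y}).restrictScalars K := by
      rw [IntermediateField.adjoin_le_iff]
      rintro z (rfl | rfl)
      · exact (IntermediateField.adjoin k {y}).algebraMap_mem ⟨z, hxk⟩
      · exact IntermediateField.subset_adjoin k {z} rfl
    rw [h.adjoin_eq_top] at h1
    exact eq_top_iff.2 fun z _ => h1 IntermediateField.mem_top
  obtain ⟨φ, hφ⟩ := IntermediateField.exists_algHom_of_adjoin_splits_of_aeval
    (F := k) (E := F) (K := F) (S := {y}) (x := y) (y := -y) (by
      rintro s rfl
      refine ⟨⟨X ^ 2 - C a, monic_X_pow_sub_C a _root_.two_ne_zero, by simp [ha]⟩, ?_⟩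
      have : (minpoly k s).map (algebraMap k F) = (X - C s) * (X - C (-s)) := by
        rw [← hmin, Polynomial.map_sub, Polynomial.map_pow, map_X, map_C, ha]
        simp only [C_pow, C_neg]
        ring
      rw [this]
      exact (Splits.X_sub_C _).mul (Splits.X_sub_C _)) htop (by simp [← hmin, ha])
  have hφx : φ x = x := φ.commutes ⟨x, hxk⟩
  have hsurj : Function.Surjective (φ.restrictScalars K) := by
    have h1 : IntermediateField.adjoin K {x, y} ≤ (φ.restrictScalars K).fieldRange := by
      rw [IntermediateField.adjoin_le_iff]
      rintro z (rfl | rfl)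
      · exact ⟨z, hφx⟩
      · exact ⟨-z, by simp [hφ]⟩
    rw [h.adjoin_eq_top] at h1
    exact fun z => h1 IntermediateField.mem_top
  exact ⟨AlgEquiv.ofBijective (φ.restrictScalars K) ⟨RingHom.injective _, hsurj⟩, hφx, hφ⟩

/-- The involution fixes u(x) and sends y - v to -(y + v), while v' ≡ -v mod u; so the local minima
agree. -/
theorem apply_comap_involution {infty : Place K F} (hinfty : infty.IsInfinite x) {u v v' : K[X]}
    {D D' : Divisor K F} (hD : IsMumford f x y infty u v D)
    (hD' : IsMumford f x y infty u v' D') (hdvd : u ∣ v' + v) {ι : F ≃ₐ[K] F} (hx : ι x = x)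
    (hy : ι y = -y) (P : Place K F) : D' P = D (P.comap ι) := by
  have hpoly : ∀ p : K[X], ι (aeval x p) = aeval x p := fun p => by
    rw [← aeval_algHom_apply, hx]
  have hmem : x ∈ (P.comap ι).ring ↔ x ∈ P.ring := by rw [Place.mem_comap_ring, hx]
  by_cases hP : P = infty
  · have : P.comap ι = infty := h.infty_unique hinfty (hmem.not.2 (hP ▸ hinfty))
    rw [this, hP, hD.apply_infty, hD'.apply_infty]
  · have hxP := h.mem_of_ne_infty hinfty hP
    have hd := h.isDiscrete (P.comap ι)
    have hv := h.sub_aeval_ne_zero v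
    have h1 := h.min_ord_congr hxP hD.monic.ne_zero (v := -v) (w := v')
      (by rw [← dvd_neg]; convert! hdvd using 1; ring)
    rw [h.apply_of_isMumford hD' hP, h1,
      h.apply_of_isMumford hD (ne_infty_of_mem hinfty (hmem.2 hxP)),
      Place.ord_comap hd (h.isQuadraticModel.aeval_ne_zero hD.monic.ne_zero),
      Place.ord_comap hd hv, hpoly, map_sub, hpoly, hy,
      ← (h.isDiscrete P).ord_neg (h.sub_aeval_ne_zero (-v)), map_neg]
    congr 2
    ring

end IsFunctionField

/-! ### Jacobian classes, tangent lines and contact orders at rational points. -/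

theorem divisorClass_add {D D' : Divisor K F} (hD : D ∈ degreeZero K F)
    (hD' : D' ∈ degreeZero K F) :
    divisorClass (D + D') (add_mem hD hD') = divisorClass D hD + divisorClass D' hD' := rfl

theorem divisorClass_eq_zero {D : Divisor K F} (hD : D ∈ degreeZero K F) {z : F}
    (hz : IsDivisorOf D z) : divisorClass D hD = 0 :=
  (QuotientAddGroup.eq_zero_iff _).2 (AddSubgroup.mem_addSubgroupOf.2
    (AddSubgroup.subset_closure ⟨z, hz⟩))

theorem degree_tangentLine_lt (f : K[X]) (a b : K) :
    (tangentLine f a b).degree < ((X - C a) ^ 2).degree := by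
  rw [degree_pow, degree_X_sub_C, tangentLine, mul_sub, sub_add, ← C_mul, ← C_sub,
    sub_eq_add_neg, ← C_neg]
  exact degree_linear_le.trans_lt (by norm_num)

theorem X_sub_C_dvd_tangentLine_sub (f : K[X]) (a b : K) : X - C a ∣ tangentLine f a b - C b :=
  ⟨C (tangentSlope f a b), by rw [tangentLine]; ring⟩

theorem dvd_sq_sub_of_dvd {u f v w : K[X]} (h1 : u ∣ v ^ 2 - f) (h2 : u ∣ w - v) :
    u ∣ w ^ 2 - f := by
  have := dvd_add (h2.mul_left (w + v)) h1
  convert! this using 1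
  ring

theorem dvd_sub_modByMonic (p : K[X]) (u : K[X]) : u ∣ p - p %ₘ u :=
  ⟨p /ₘ u, by rw [modByMonic_eq_sub_mul_div, sub_sub_cancel]⟩

namespace IsFunctionField

variable {f : K[X]} {x y : F} (h : IsFunctionField f x y)
include h

theorem not_X_sub_C_dvd {P : Place K F} {a b : K} (hP : P.IsAt x y a b) (hb : b ≠ 0) :
    ¬ X - C a ∣ f := by
  rw [dvd_iff_isRoot, IsRoot, h.eval_eq_sq hP]
  exact pow_ne_zero 2 hb

/-- As f(a) = b² ≠ 0, the place is unramified over x = a and x - a is a uniformizer. -/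
theorem ord_aeval_eq_rootMultiplicity {P : Place K F} {a b : K} (hP : P.IsAt x y a b) (hb : b ≠ 0)
    {p : K[X]} (hp : p ≠ 0) : P.ord (aeval x p) = p.rootMultiplicity a := by
  have hA := hP.isAbove
  obtain ⟨c, hc, hndvd⟩ := exists_eq_pow_rootMultiplicity_mul_and_not_dvd p hp a
  conv_lhs => rw [hc]
  rw [h.ord_aeval_pow_mul hA.mem (irreducible_X_sub_C a) hA.lt_one _ hndvd,
    h.isQuadraticModel.ord_aeval_of_not_dvd hA.mem (irreducible_X_sub_C a) hA.lt_one
      (h.not_X_sub_C_dvd hP hb), mul_one]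

/-- The residue of y + L(x) is 2b ≠ 0, so y - L carries the whole order of the norm `L ^ 2 - f`. -/
theorem hasOrder_sub_aeval {P : Place K F} {a b : K} (hP : P.IsAt x y a b) (hb : b ≠ 0)
    {L : K[X]} (hL : L.eval a = b) :
    P.HasOrder (y - aeval x L) ((L ^ 2 - f).rootMultiplicity a) := by
  have hA := hP.isAbove
  have hd := h.isDiscrete P
  have hp := h.add_aeval_ne_zero L
  convert! hd.hasOrder_ord (h.sub_aeval_ne_zero L) using 1
  rw [← h.ord_aeval_eq_rootMultiplicity hP hb (h.norm_ne_zero L), ← h.ord_sub_add_ord_add]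
  have hmem := add_mem (h.isQuadraticModel.right_mem_ring hA.mem) (Place.aeval_mem hA.mem L)
  have hzero : P.ord (y + aeval x L) = 0 := by
    refine le_antisymm (not_lt.1 fun hpos => hb ?_) ((hd.ord_nonneg_iff hp).2 hmem)
    rw [hd.ord_pos_iff hp] at hpos
    have h1 : P.ring.valuation (aeval x L - aeval x (C b)) < 1 := by
      rw [← map_sub, ← hL]
      exact Place.valuation_aeval_lt_one_of_dvd hA.mem hA.lt_one X_sub_C_dvd_sub_C_eval
    have h2 := Valuation.map_sub_lt _ hpos (Valuation.map_add_lt _ hA.sub_lt_one h1)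
    rw [show y + aeval x L - (y - aeval x (C b) + (aeval x L - aeval x (C b))) =
      2 * aeval x (C b) by ring, map_mul, h.valuation_two, one_mul, aeval_C] at h2
    exact P.eq_zero_of_algebraMap_lt_one h2
  rw [hzero, add_zero]

theorem degree_eq_one {P : Place K F} {a b : K} (hP : P.IsAt x y a b) : P.degree = 1 := by
  rw [h.isQuadraticModel.degree_eq (irreducible_X_sub_C a) (h.not_sq_dvd (irreducible_X_sub_C a))
    hP.isAbove, natDegree_X_sub_C]

variable {infty : Place K F} (hinfty : infty.IsInfinite x)
include hinfty

/-- The representation ⟨x - a, b⟩ of the point multiplied by itself: the tangent line is congruent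
to b mod x - a, and tangency supplies the divisibility by (x - a)². -/
theorem isMumford_tangentLine {P : Place K F} {a b : K} (hP : P.IsAt x y a b) (hb : b ≠ 0) :
    IsMumford f x y infty ((X - C a) ^ 2) (tangentLine f a b)
      (Finsupp.single P 2 - Finsupp.single infty 2) := by
  have h1 := h.isMumford_of_irreducible hinfty (monic_X_sub_C a) (irreducible_X_sub_C a)
    (by simp) (by rw [degree_X_sub_C]; exact degree_C_le.trans_lt one_pos) hP.isAbove
  have h2 := degree_tangentLine_lt f a b
  have h3 := sq_dvd_tangentLine_sq_sub h.two_ne_zero hb (h.eval_eq_sq hP)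
  have h4 := X_sub_C_dvd_tangentLine_sub f a b
  rw [sq] at h2 h3 ⊢
  convert! h.isMumford_mul hinfty h1 h1 (by rw [← sq, natDegree_pow]; simp) h2 h3 h4 h4 using 1
  rw [natDegree_X_sub_C, sub_add_sub_comm, ← Finsupp.single_add, ← Finsupp.single_add]
  rfl

theorem mem_degreeZero_of_isAt {P Q : Place K F} {a b c d : K} (hP : P.IsAt x y a b)
    (hQ : Q.IsAt x y c d) :
    (Finsupp.single P 1 + Finsupp.single Q 1 - Finsupp.single infty 2 : Divisor K F) ∈
      degreeZero K F := by
  rw [mem_degreeZero_iff, map_sub, map_add, divisorDegree_single, divisorDegree_single,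
    divisorDegree_single, h.degree_infty hinfty, h.degree_eq_one hP,
    h.degree_eq_one hQ]
  norm_num

end IsFunctionField

end FunctionField

end GenusTwo

/-! ### The doubling theorem. -/

theorem mainTheorem2 {K F : Type*} [Field K] [Field F] [Algebra K F]
    (f : K[X]) (x y : F) (hF : IsFunctionField f x y)
    (infty μ ω : Place K F) (hinfty : infty.IsInfinite x)
    (μx μy ωx ωy : K) (hμ : μ.IsAt x y μx μy) (hω : ω.IsAt x y ωx ωy)
    (hμω : μx ≠ ωx) (hμy : μy ≠ 0) (hωy : ωy ≠ 0) :
    let D : Divisor K F := Finsupp.single μ 1 + Finsupp.single ω 1 - Finsupp.single infty 2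
    let D₁ : Divisor K F := Finsupp.single μ 2 - Finsupp.single infty 2
    let D₂ : Divisor K F := Finsupp.single ω 2 - Finsupp.single infty 2
    let u₁ : K[X] := (X - C μx) ^ 2
    let v₁ : K[X] := tangentLine f μx μy
    let u₂ : K[X] := (X - C ωx) ^ 2
    let v₂ : K[X] := tangentLine f ωx ωy
    let M : Matrix (Fin 4) (Fin 4) K :=
      interpolationMatrix (-2 * μx) (μx ^ 2) (-2 * ωx) (ωx ^ 2)
    let rhs : Fin 4 → K :=
      ![tangentSlope f μx μy, μy - tangentSlope f μx μy * μx,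
        tangentSlope f ωx ωy, ωy - tangentSlope f ωx ωy * ωx]
    -- the two summands and their Mumford forms
    (∃ (hD : D ∈ degreeZero K F) (hD₁ : D₁ ∈ degreeZero K F) (hD₂ : D₂ ∈ degreeZero K F),
      (2 : ℕ) • divisorClass D hD = divisorClass D₁ hD₁ + divisorClass D₂ hD₂) ∧
    IsMumford f x y infty u₁ v₁ D₁ ∧
    IsMumford f x y infty u₂ v₂ D₂ ∧
    -- the linear system
    M = !![3 * μx ^ 2, 2 * μx, 1, 0;
           -2 * μx ^ 3, -μx ^ 2, 0, 1;
           3 * ωx ^ 2, 2 * ωx, 1, 0;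
           -2 * ωx ^ 3, -ωx ^ 2, 0, 1] ∧
    (∀ w : Fin 4 → K, M.mulVec w = rhs ↔ u₁ ∣ cubic w - v₁ ∧ u₂ ∣ cubic w - v₂) ∧
    (∃! w : Fin 4 → K, M.mulVec w = rhs) ∧
    -- what the solution of the system gives
    ∀ w : Fin 4 → K, M.mulVec w = rhs →
      let L : K[X] := cubic w
      let q : K[X] := (L ^ 2 - f) /ₘ (u₁ * u₂)
      let u₃ : K[X] := C q.leadingCoeff⁻¹ * q
      let v₃ : K[X] := (-L) %ₘ u₃
      L ^ 2 - f = u₁ * u₂ * q ∧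
      (w 0 ≠ 0 → u₃.natDegree = 2) ∧
      (w 0 = 0 → u₃.natDegree = 1) ∧
      -- multiplicities of `y - L(x)` at `μ` and at `ω`
      μ.HasOrder (y - aeval x L) (2 + (u₃.rootMultiplicity μx : ℤ)) ∧
      ω.HasOrder (y - aeval x L) (2 + (u₃.rootMultiplicity ωx : ℤ)) ∧
      -- the residual intersection, the hyperelliptic involution, and the doubled class
      ∃ E D₃ : Divisor K F,
        IsMumford f x y infty u₃ (L %ₘ u₃) E ∧
        IsDivisorOf (D₁ + D₂ + E) (y - aeval x L) ∧
        IsMumford f x y infty u₃ v₃ D₃ ∧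
        (∃ ι : F ≃ₐ[K] F, ι x = x ∧ ι y = -y ∧ ∀ P : Place K F, D₃ P = E (P.comap ι)) ∧
        ∃ (hD : D ∈ degreeZero K F) (hE : E ∈ degreeZero K F) (hD₃ : D₃ ∈ degreeZero K F),
          divisorClass D₃ hD₃ = -divisorClass E hE ∧
          (2 : ℕ) • divisorClass D hD = divisorClass D₃ hD₃ := by
  intro D D₁ D₂ u₁ v₁ u₂ v₂ M rhs
  have hμL := hF.eval_eq_sq hμ
  have hωL := hF.eval_eq_sq hω
  have hM₁ : IsMumford f x y infty u₁ v₁ D₁ := hF.isMumford_tangentLine hinfty hμ hμy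
  have hM₂ : IsMumford f x y infty u₂ v₂ D₂ := hF.isMumford_tangentLine hinfty hω hωy
  have hD : D ∈ degreeZero K F := hF.mem_degreeZero_of_isAt hinfty hμ hω
  have hD₁ : D₁ ∈ degreeZero K F := by
    have := hF.mem_degreeZero_of_isAt hinfty hμ hμ
    rwa [← Finsupp.single_add] at this
  have hD₂ : D₂ ∈ degreeZero K F := by
    have := hF.mem_degreeZero_of_isAt hinfty hω hω
    rwa [← Finsupp.single_add] at this
  have hsum : D + D = D₁ + D₂ := by
    have e : ∀ (P : Place K F), (Finsupp.single P 2 : Divisor K F) =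
        Finsupp.single P 1 + Finsupp.single P 1 := fun P => by
      rw [← Finsupp.single_add]
      rfl
    simp only [D, D₁, D₂, e μ, e ω]
    abel
  have htwo : (2 : ℕ) • divisorClass D hD = divisorClass D₁ hD₁ + divisorClass D₂ hD₂ := by
    rw [two_nsmul, ← divisorClass_add, ← divisorClass_add]
    congr 1
  have hiff : ∀ w : Fin 4 → K, M.mulVec w = rhs ↔ u₁ ∣ cubic w - v₁ ∧ u₂ ∣ cubic w - v₂ :=
    mulVec_interpolationMatrix_iff f μx μy ωx ωy
  refine ⟨⟨hD, hD₁, hD₂, htwo⟩, hM₁, hM₂, interpolationMatrix_square μx ωx, hiff,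
    existsUnique_mulVec M ?_ rhs, fun w hw => ?_⟩
  · rw [det_interpolationMatrix_square]
    exact pow_ne_zero 4 (sub_ne_zero.2 hμω)
  intro L q u₃ v₃
  obtain ⟨hL₁, hL₂⟩ := (hiff w).1 hw
  have hL3 : L.natDegree ≤ 3 := natDegree_cubic_le w
  have hdvd : u₁ * u₂ ∣ L ^ 2 - f := (isCoprime_sq hμω).mul_dvd
    (dvd_sq_sub_of_dvd hM₁.dvd hL₁) (dvd_sq_sub_of_dvd hM₂.dvd hL₂)
  have hmonic : (u₁ * u₂).Monic := hM₁.monic.mul hM₂.monic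
  have hq : L ^ 2 - f = u₁ * u₂ * q := by
    have := modByMonic_add_div (L ^ 2 - f) (u₁ * u₂)
    rw [(modByMonic_eq_zero_iff_dvd hmonic).2 hdvd, zero_add] at this
    exact this.symm
  have hN0 := hF.norm_ne_zero L
  have hq0 : q ≠ 0 := right_ne_zero_of_mul (hq ▸ hN0)
  have hlc : q.leadingCoeff ≠ 0 := leadingCoeff_ne_zero.2 hq0
  have hu₃ : u₃.Monic := by
    rw [Monic, leadingCoeff_mul, leadingCoeff_C, inv_mul_cancel₀ hlc]
  have hqu : q = C q.leadingCoeff * u₃ := by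
    rw [← mul_assoc, ← C_mul, mul_inv_cancel₀ hlc, C_1, one_mul]
  have hN : L ^ 2 - f = C q.leadingCoeff * (u₁ * u₂ * u₃) := by
    rw [hq]
    conv_lhs => rw [hqu]
    ring
  have hdu₁ : u₁.natDegree = 2 := by simp [u₁, natDegree_pow]
  have hdu₂ : u₂.natDegree = 2 := by simp [u₂, natDegree_pow]
  -- This count gives deg u₃ = 6 - 4 or 5 - 4, and also makes the coefficients at infinity add up to
  -- the order of y - L there.
  have hdeg : u₁.natDegree + u₂.natDegree + u₃.natDegree = if L.natDegree = 3 then 6 else 5 := by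
    rw [← natDegree_sq_sub hF.natDegree_eq hL3, hN, natDegree_C_mul hlc,
      hmonic.natDegree_mul hu₃, hM₁.monic.natDegree_mul hM₂.monic]
  have hiff3 : L.natDegree = 3 ↔ w 0 ≠ 0 := natDegree_cubic_eq_three_iff w
  have hdeg2 : w 0 ≠ 0 → u₃.natDegree = 2 := fun h0 => by
    rw [if_pos (hiff3.2 h0)] at hdeg
    omega
  have hdeg1 : w 0 = 0 → u₃.natDegree = 1 := fun h0 => by
    rw [if_neg fun h3 => hiff3.1 h3 h0] at hdeg
    omega
  have hord : ∀ {P : Place K F} {a b : K}, P.IsAt x y a b → b ≠ 0 → L.eval a = b →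
      (u₁ * u₂).rootMultiplicity a = 2 →
      P.HasOrder (y - aeval x L) (2 + (u₃.rootMultiplicity a : ℤ)) := by
    intro P a b hP hb hLa hm
    have h1 := hF.hasOrder_sub_aeval hP hb hLa
    have h2 : (L ^ 2 - f).rootMultiplicity a = 2 + u₃.rootMultiplicity a := by
      rw [hN, rootMultiplicity_mul (hN ▸ hN0), rootMultiplicity_C, zero_add,
        rootMultiplicity_mul (hmonic.mul hu₃).ne_zero, hm]
    rw [h2] at h1
    exact_mod_cast h1
  have heval : ∀ {a b : K}, (X - C a) ^ 2 ∣ L - tangentLine f a b → L.eval a = b := by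
    intro a b hab
    have h1 := dvd_iff_isRoot.1 ((dvd_pow_self _ two_ne_zero).trans hab)
    rw [IsRoot, eval_sub, sub_eq_zero] at h1
    rw [h1]
    simp [tangentLine]
  have hm : ∀ {a b : K}, a ≠ b →
      ((X - C a) ^ 2 * (X - C b) ^ 2).rootMultiplicity a = 2 := by
    intro a b hab
    rw [rootMultiplicity_mul (((monic_X_sub_C a).pow 2).mul ((monic_X_sub_C b).pow 2)).ne_zero,
      rootMultiplicity_X_sub_C_pow, rootMultiplicity_eq_zero]
    simpa [IsRoot, sub_eq_zero] using hab
  have hv : ∀ p : K[X], (p %ₘ u₃).degree < u₃.degree := fun p => degree_modByMonic_lt p hu₃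
  have hu₃dvd : u₃ ∣ L ^ 2 - f := hN ▸ (dvd_mul_left _ _).mul_left _
  have hmod : ∀ p : K[X], u₃ ∣ p ^ 2 - f → u₃ ∣ (p %ₘ u₃) ^ 2 - f := fun p hp =>
    dvd_sq_sub_of_dvd hp ((dvd_sub_comm).1 (dvd_sub_modByMonic p u₃))
  have hu₃0 : u₃.natDegree ≠ 0 := by
    by_cases h0 : w 0 = 0
    · simp [hdeg1 h0]
    · simp [hdeg2 h0]
  have hu₃2 : u₃.natDegree ≤ 2 := by
    by_cases h0 : w 0 = 0
    · simp [hdeg1 h0]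
    · simp [hdeg2 h0]
  obtain ⟨E, hME, hE⟩ := hF.exists_isMumford hinfty hu₃ hu₃0 hu₃2 (hv L) (hmod L hu₃dvd)
  obtain ⟨D₃, hMD₃, hD₃⟩ := hF.exists_isMumford hinfty hu₃ hu₃0 hu₃2 (hv (-L))
    (hmod (-L) (by rwa [neg_sq]))
  have hneg : u₃ ∣ v₃ + L %ₘ u₃ := by
    rw [show v₃ = -(L %ₘ u₃) from neg_modByMonic L u₃, neg_add_cancel]
    exact dvd_zero _
  have hprin := hF.isDivisorOf_sub_aeval hinfty hlc hN hL3 hdeg hM₁ hM₂ hME hL₁ hL₂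
    (dvd_sub_modByMonic L u₃)
  obtain ⟨ι, hιx, hιy⟩ := hF.exists_involution
  have hDE : divisorClass D₃ hD₃ = -divisorClass E hE := by
    rw [eq_neg_iff_add_eq_zero, add_comm, ← divisorClass_add]
    exact divisorClass_eq_zero _ (hF.isDivisorOf_aeval hinfty hME hMD₃ hneg)
  refine ⟨hq, hdeg2, hdeg1, hord hμ hμy (heval hL₁) (hm hμω),
    hord hω hωy (heval hL₂) (by rw [mul_comm]; exact hm hμω.symm), E, D₃, hME, hprin, hMD₃,
    ⟨ι, hιx, hιy, hF.apply_comap_involution hinfty hME hMD₃ hneg hιx hιy⟩, hD, hE, hD₃, hDE, ?_⟩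
  -- With [D₃] = -[E], the claim is that D₁ + D₂ + E is principal, and it is the divisor of y -
  -- L(x).
  rw [htwo, hDE, eq_neg_iff_add_eq_zero, ← divisorClass_add, ← divisorClass_add]
  exact divisorClass_eq_zero _ hprin
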